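/- Let $q$ be a power of $2$ and $Q$ a quadratic form on a finite-dimensional $\mathbb{F}_q$-vector space $V$, with associated bilinear form $\langle x,y\rangle=Q(x+y)+Q(x)+Q(y)$. Call $Q$ non-degenerate if no nonzero vector $x$ satisfies both $Q(x)=0$ and $\langle x,\cdot\rangle=0$, and the radical of $\langle\cdot,\cdot\rangle$ has dimension at most $1$. The Witt index of $Q$ is the largest dimension of a subspace on which $Q$ vanishes. A non-degenerate form on a space of dimension $2m$ has type $+1$ (hyperbolic) if its Witt index is $m$ and type $-1$ (elliptic) if its Witt index is $m-1$; a non-degenerate form on a space of dimension $2m+1$ is parabolic if its Witt index is $m$. A subspace $S\subseteq V$ meets the quadric $Q=0$ in a degenerate quadric if the restriction $Q|_S$ is degenerate; a projective line with this property is called tangent. Let $m\ge 1$ and $\varepsilon\in\{+1,-1\}$. - $NO^{\varepsilon}(2m,2)$: let $Q$ be a quadratic form of type $\varepsilon$ on $\mathbb{F}_2^{2m}$. The vertices are the points of $PG(2m-1,2)$ not on the quadric $Q=0$; two distinct vertices are adjacent if and only if they lie on a line tangent to the quadric. - $NO^{\varepsilon}(2m+1,q)$: let $Q$ be a parabolic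 quadratic form on $\mathbb{F}_q^{2m+1}$; its nucleus is the radical of $\langle\cdot,\cdot\rangle$. The vertices are the hyperplanes $H$ that do not contain the nucleus and for which $Q|_H$ is non-degenerate of type $\varepsilon$; two distinct vertices $H_1,H_2$ are adjacent if and only if $H_1\cap H_2$ meets the quadric in a degenerate quadric. - A two-graph is a set $X$ together with a set of $3$-subsets of $X$ such that every $4$-subset of $X$ contains an even number of them. An isomorphism of two-graphs is a bijection of the vertex sets that maps the one set of triples onto the other. The two-graph of a graph consists of the triples of vertices that span an odd number of edges. - The symplectic two-graph $\mathcal{X}^{\varepsilon}_{2m}$: let $Q$ be a quadratic form of type $\varepsilon$ on $\mathbb{F}_2^{2m}$. The vertex set is $\{a\in\mathbb{F}_2^{2m}: Q(a)=1\}$, and the triples are the $\{a,b,c\}$ with $a,b,c$ distinct and $\langle a,b\rangle+\langle a,c\rangle+\langle b,c\rangle=0$. - Switching a graph with respect to a set $Y$ of vertices exchanges edges and non-edges between $Y$ and its complement and leaves all other pairs unchanged. Two graphs are switching equivalent if one of them is isomorphic to a switching of the other. **Theorem.** For all $m\ge 1$ and $\varepsilon\in\{+1,-1\}$, and for every choice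 of the quadratic forms used to define the objects below: (i) the two-graph of $NO^{\varepsilon}(2m,2)$ is isomorphic to $\mathcal{X}^{\varepsilon}_{2m}$; (ii) the two-graph of $NO^{-\varepsilon}(2m+1,4)$ is isomorphic to $\mathcal{X}^{\varepsilon}_{4m}$; (iii) the graphs $NO^{\varepsilon}(4m,2)$ and $NO^{-\varepsilon}(2m+1,4)$ are switching equivalent. -/

import Mathlib

namespace PolarTwoGraph

section TwoGraphs

/-- A two-graph on `X`: a set of unordered triples such that every 4-subset of `X` contains an
even number of these triples. -/
structure TwoGraph (X : Type*) where
  triples : Set (Finset X)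
  card_eq_three : ∀ t ∈ triples, t.card = 3
  even_quadruple : ∀ s : Finset X, s.card = 4 → Even {t ∈ triples | t ⊆ s}.ncard

/-- An isomorphism of two-graphs: a bijection of the vertex sets that maps the triples of the first
exactly onto the triples of the second. -/
structure TwoGraph.Iso {X Y : Type*} (S : TwoGraph X) (T : TwoGraph Y) where
  toEquiv : X ≃ Y
  map_mem_iff : ∀ t : Finset X, t.map toEquiv.toEmbedding ∈ T.triples ↔ t ∈ S.triples

theorem mem_triple_iff {X : Type*} [DecidableEq X] (χ : X → X → ZMod 2)
    (hχ : ∀ x y, χ x y = χ y x) {a b c : X} (hab : a ≠ b) (hac : a ≠ c) (hbc : b ≠ c) :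
    (∃ x y z : X, x ≠ y ∧ x ≠ z ∧ y ≠ z ∧ ({a, b, c} : Finset X) = {x, y, z} ∧
      χ x y + χ x z + χ y z = 0) ↔ χ a b + χ a c + χ b c = 0 := by
  constructor
  · rintro ⟨x, y, z, hxy, hxz, hyz, h, hs⟩
    have hx : x = a ∨ x = b ∨ x = c := by
      have : x ∈ ({a, b, c} : Finset X) := by rw [h]; simp
      simpa using this
    have hy : y = a ∨ y = b ∨ y = c := by
      have : y ∈ ({a, b, c} : Finset X) := by rw [h]; simp
      simpa using this
    have hz : z = a ∨ z = b ∨ z = c := by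
      have : z ∈ ({a, b, c} : Finset X) := by rw [h]; simp
      simpa using this
    have h1 := hχ a b
    have h2 := hχ a c
    have h3 := hχ b c
    grind
  · intro h
    exact ⟨a, b, c, hab, hac, hbc, rfl, h⟩

theorem even_quadruple_of_symm {X : Type*} (χ : X → X → ZMod 2)
    (hχ : ∀ x y, χ x y = χ y x) (T : Set (Finset X)) (hT3 : ∀ t ∈ T, t.card = 3)
    (hT : ∀ t, t ∈ T ↔ ∃ x y z : X, x ≠ y ∧ x ≠ z ∧ y ≠ z ∧
      (∀ w, w ∈ t ↔ w = x ∨ w = y ∨ w = z) ∧ χ x y + χ x z + χ y z = 0)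
    (s : Finset X) (hs : s.card = 4) : Even {t ∈ T | t ⊆ s}.ncard := by
  classical
  have hmem : ∀ a b c : X, a ≠ b → a ≠ c → b ≠ c →
      (({a, b, c} : Finset X) ∈ T ↔ χ a b + χ a c + χ b c = 0) := by
    intro a b c hab hac hbc
    rw [hT, ← mem_triple_iff χ hχ hab hac hbc]
    simp only [Finset.ext_iff, Finset.mem_insert, Finset.mem_singleton]
  obtain ⟨a, b, c, d, hab, hac, had, hbc, hbd, hcd, rfl⟩ := Finset.card_eq_four.mp hs
  have hset : {t ∈ T | t ⊆ ({a, b, c, d} : Finset X)} =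
      (({{a, b, c}, {a, b, d}, {a, c, d}, {b, c, d}} : Finset (Finset X)).filter (· ∈ T) :
        Finset (Finset X)) := by
    ext t
    simp only [Set.mem_ofPred_eq, Finset.coe_filter, Finset.mem_insert, Finset.mem_singleton]
    constructor
    · rintro ⟨ht, hts⟩
      refine ⟨?_, ht⟩
      have h3 := hT3 t ht
      have hcard : (({a, b, c, d} : Finset X) \ t).card = 1 := by
        rw [Finset.card_sdiff_of_subset hts]; omega
      obtain ⟨w, hw⟩ := Finset.card_eq_one.mp hcard
      have ht' : t = ({a, b, c, d} : Finset X) \ {w} := by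
        rw [← hw, Finset.sdiff_sdiff_eq_self hts]
      have hw' : w ∈ ({a, b, c, d} : Finset X) := by
        have : w ∈ ({a, b, c, d} : Finset X) \ t := by rw [hw]; simp
        exact (Finset.mem_sdiff.mp this).1
      simp only [Finset.mem_insert, Finset.mem_singleton] at hw'
      rcases hw' with rfl | rfl | rfl | rfl
      · right; right; right; rw [ht']; ext x; simp; grind
      · right; right; left; rw [ht']; ext x; simp; grind
      · right; left; rw [ht']; ext x; simp; grind
      · left; rw [ht']; ext x; simp; grind
    · rintro ⟨h, ht⟩
      refine ⟨ht, ?_⟩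
      rcases h with rfl | rfl | rfl | rfl <;> intro x <;> simp <;> grind
  rw [hset, Set.ncard_coe_finset, ← ZMod.natCast_eq_zero_iff_even, Finset.card_filter]
  have ne : ∀ (u v : Finset X) (w : X), w ∈ u → w ∉ v → u ≠ v := by
    rintro u v w h1 h2 rfl
    exact h2 h1
  have n1 : ({a, b, c} : Finset X) ∉
      ({{a, b, d}, {a, c, d}, {b, c, d}} : Finset (Finset X)) := by
    simp only [Finset.mem_insert, Finset.mem_singleton, not_or]
    exact ⟨ne _ _ c (by simp) (by simp [hac.symm, hbc.symm, hcd]),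
      ne _ _ b (by simp) (by simp [hab.symm, hbc, hbd]),
      ne _ _ a (by simp) (by simp [hab, hac, had])⟩
  have n2 : ({a, b, d} : Finset X) ∉ ({{a, c, d}, {b, c, d}} : Finset (Finset X)) := by
    simp only [Finset.mem_insert, Finset.mem_singleton, not_or]
    exact ⟨ne _ _ b (by simp) (by simp [hab.symm, hbc, hbd]),
      ne _ _ a (by simp) (by simp [hab, hac, had])⟩
  have n3 : ({a, c, d} : Finset X) ∉ ({{b, c, d}} : Finset (Finset X)) := by
    simp only [Finset.mem_singleton]
    exact ne _ _ a (by simp) (by simp [hab, hac, had])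
  rw [Finset.sum_insert n1, Finset.sum_insert n2, Finset.sum_insert n3, Finset.sum_singleton]
  simp only [hmem a b c hab hac hbc, hmem a b d hab had hbd, hmem a c d hac had hcd,
    hmem b c d hbc hbd hcd]
  push_cast
  generalize χ a b = x1
  generalize χ a c = x2
  generalize χ a d = x3
  generalize χ b c = x4
  generalize χ b d = x5
  generalize χ c d = x6
  revert x1 x2 x3 x4 x5 x6
  decide

theorem ncard_edgeSet_induce_triple {V : Type*} [DecidableEq V] (G : SimpleGraph V)
    [DecidableRel G.Adj] {a b c : V} (hab : a ≠ b) (hac : a ≠ c) (hbc : b ≠ c) :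
    (G.induce (({a, b, c} : Finset V) : Set V)).edgeSet.ncard =
      (if G.Adj a b then 1 else 0) + (if G.Adj a c then 1 else 0) +
        (if G.Adj b c then 1 else 0) := by
  rw [← Set.ncard_image_of_injective _
    (Sym2.map.injective (Subtype.val_injective (p := (· ∈ (({a, b, c} : Finset V) : Set V)))))]
  have h : Sym2.map (Subtype.val (p := (· ∈ (({a, b, c} : Finset V) : Set V)))) ''
      (G.induce (({a, b, c} : Finset V) : Set V)).edgeSet =
      ((({s(a, b), s(a, c), s(b, c)} : Finset (Sym2 V)).filter (· ∈ G.edgeSet) :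
        Finset (Sym2 V)) : Set (Sym2 V)) := by
    ext e
    induction e using Sym2.ind with
    | _ x y =>
      simp only [Set.mem_image, Finset.coe_filter, Set.mem_ofPred_eq, Finset.mem_insert,
        Finset.mem_singleton, SimpleGraph.mem_edgeSet]
      constructor
      · rintro ⟨e', he', h⟩
        induction e' using Sym2.ind with
        | _ u v =>
          obtain ⟨u, hu⟩ := u
          obtain ⟨v, hv⟩ := v
          simp only [SimpleGraph.mem_edgeSet, SimpleGraph.comap_adj, Sym2.map_mk] at he' h
          have hadj : G.Adj u v := he'
          have hne := hadj.ne
          have hsymm := hadj.symm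
          simp only [Finset.coe_insert, Finset.coe_singleton, Set.mem_insert_iff,
            Set.mem_singleton_iff] at hu hv
          simp only [Sym2.eq_iff] at h ⊢
          grind
      · rintro ⟨h, hadj⟩
        have hx : x ∈ (({a, b, c} : Finset V) : Set V) := by
          simp only [Sym2.eq_iff] at h
          simp only [Finset.coe_insert, Finset.coe_singleton, Set.mem_insert_iff,
            Set.mem_singleton_iff]
          grind
        have hy : y ∈ (({a, b, c} : Finset V) : Set V) := by
          simp only [Sym2.eq_iff] at h
          simp only [Finset.coe_insert, Finset.coe_singleton, Set.mem_insert_iff,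
            Set.mem_singleton_iff]
          grind
        exact ⟨s(⟨x, hx⟩, ⟨y, hy⟩), hadj, rfl⟩
  rw [h, Set.ncard_coe_finset, Finset.card_filter]
  have n1 : s(a, b) ∉ ({s(a, c), s(b, c)} : Finset (Sym2 V)) := by
    simp only [Finset.mem_insert, Finset.mem_singleton, Sym2.eq_iff]; grind
  have n2 : s(a, c) ∉ ({s(b, c)} : Finset (Sym2 V)) := by
    simp only [Finset.mem_singleton, Sym2.eq_iff]; grind
  rw [Finset.sum_insert n1, Finset.sum_insert n2, Finset.sum_singleton, add_assoc]
  simp only [SimpleGraph.mem_edgeSet]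

/-- The two-graph associated with a graph `G`: the triples of vertices whose induced subgraph has an
odd number of edges. -/
def associatedTwoGraph {V : Type*} (G : SimpleGraph V) : TwoGraph V where
  triples := {t | t.card = 3 ∧ Odd (G.induce (t : Set V)).edgeSet.ncard}
  card_eq_three := fun _ ht => ht.1
  even_quadruple := by
    classical
    refine even_quadruple_of_symm (fun x y => if G.Adj x y then 0 else 1)
      (fun x y => by simp only [G.adj_comm]) _ (fun _ ht => ht.1) ?_
    have key : ∀ a b c : V, a ≠ b → a ≠ c → b ≠ c →
        (Odd (G.induce (({a, b, c} : Finset V) : Set V)).edgeSet.ncard ↔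
          ((if G.Adj a b then 0 else 1) + (if G.Adj a c then 0 else 1) +
            (if G.Adj b c then 0 else 1) : ZMod 2) = 0) := by
      intro a b c hab hac hbc
      rw [ncard_edgeSet_induce_triple G hab hac hbc]
      split_ifs <;> decide
    intro t
    constructor
    · rintro ⟨h3, hodd⟩
      obtain ⟨a, b, c, hab, hac, hbc, rfl⟩ := Finset.card_eq_three.mp h3
      exact ⟨a, b, c, hab, hac, hbc, by simp, (key a b c hab hac hbc).mp hodd⟩
    · rintro ⟨a, b, c, hab, hac, hbc, ht, hsum⟩
      obtain rfl : t = {a, b, c} := by ext w; simp [ht]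
      exact ⟨Finset.card_eq_three.mpr ⟨a, b, c, hab, hac, hbc, rfl⟩,
        (key a b c hab hac hbc).mpr hsum⟩

/-- Seidel switching of `G` with respect to `Y`: the edges and non-edges between `Y` and its
complement are exchanged, all other pairs are left unchanged. -/
def seidelSwitch {V : Type*} (G : SimpleGraph V) (Y : Set V) : SimpleGraph V where
  Adj u v := ((u ∈ Y ↔ v ∈ Y) ∧ G.Adj u v) ∨ (¬(u ∈ Y ↔ v ∈ Y) ∧ ¬G.Adj u v)
  symm := ⟨fun u v h => by
    rw [G.adj_comm v u, iff_comm (a := v ∈ Y)]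
    exact h⟩
  loopless := ⟨fun u h => by simp at h⟩

/-- Two graphs are switching equivalent if one of them is isomorphic to a Seidel switching of the
other. (A series of switchings amounts to the single switching with respect to the symmetric
difference of the switching sets.) -/
def SwitchingEquivalent {V W : Type*} (G : SimpleGraph V) (H : SimpleGraph W) : Prop :=
  ∃ Y : Set V, Nonempty (seidelSwitch G Y ≃g H)

end TwoGraphs

section QuadraticForms

variable {K V : Type*} [Field K] [AddCommGroup V] [Module K V]

/-- The Witt index: the largest dimension of a totally singular subspace. -/
noncomputable def wittIndex (Q : QuadraticForm K V) : ℕ :=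
  sSup {d | ∃ W : Submodule K V, (∀ x ∈ W, Q x = 0) ∧ Module.finrank K W = d}

/-- Hyperbolic forms: non-degenerate, of dimension `2m` and Witt index `m`. -/
def IsHyperbolic (Q : QuadraticForm K V) : Prop :=
  Q.Nondegenerate ∧ Module.finrank K V = 2 * wittIndex Q

/-- Elliptic forms: non-degenerate, of dimension `2m` and Witt index `m - 1`. -/
def IsElliptic (Q : QuadraticForm K V) : Prop :=
  Q.Nondegenerate ∧ Module.finrank K V = 2 * (wittIndex Q + 1)

/-- Parabolic forms: non-degenerate, of dimension `2m + 1` and Witt index `m`. -/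
def IsParabolic (Q : QuadraticForm K V) : Prop :=
  Q.Nondegenerate ∧ Module.finrank K V = 2 * wittIndex Q + 1

/-- A form of type `ε = ±1`: hyperbolic if `ε = 1`, elliptic if `ε = -1`. -/
def IsOfType (Q : QuadraticForm K V) (ε : ℤˣ) : Prop :=
  if ε = 1 then IsHyperbolic Q else IsElliptic Q

/-- The quadric of `Q`, a set of points of the projective space of `V`. -/
def quadric (Q : QuadraticForm K V) : Set (Projectivization K V) :=
  {p | ∀ v ∈ p.submodule, Q v = 0}

/-- The quadric of `Q` meets (the projective space of) the subspace `S` in a degenerate quadric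
of `S`, that is, the restriction of `Q` to `S` is degenerate. -/
def MeetsDegenerately (Q : QuadraticForm K V) (S : Submodule K V) : Prop :=
  ¬ (Q.restrict S).Nondegenerate

/-- The vertices are the projective points off the quadric of `Q`; two distinct ones are adjacent if
they lie on a line tangent to the quadric. For `Q` of type `±1` on the space of dimension `2m` over
the field with two elements this is the graph `NO^±(2m,2)`. -/
def evenNO (Q : QuadraticForm K V) : SimpleGraph {p : Projectivization K V // p ∉ quadric Q} where
  Adj p r := p ≠ r ∧ ∃ L : Submodule K V, Module.finrank K L = 2 ∧
    p.1.submodule ≤ L ∧ r.1.submodule ≤ L ∧ MeetsDegenerately Q L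
  symm := ⟨fun _ _ h => ⟨h.1.symm, h.2.imp fun _ hL => ⟨hL.1, hL.2.2.1, hL.2.1, hL.2.2.2⟩⟩⟩
  loopless := ⟨fun _ h => h.1 rfl⟩

/-- The nucleus of the quadric of a parabolic form in characteristic two: the radical of the
associated bilinear form. -/
def nucleus (Q : QuadraticForm K V) : Submodule K V :=
  LinearMap.ker Q.polarBilin

/-- The hyperplanes that do not contain the nucleus and that meet the quadric of `Q` in a
non-singular quadric of type `ε`. -/
def hyperplanesOfType (Q : QuadraticForm K V) (ε : ℤˣ) : Set (Submodule K V) :=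
  {H | Module.finrank K H + 1 = Module.finrank K V ∧ ¬ nucleus Q ≤ H ∧
    IsOfType (Q.restrict H) ε}

/-- The vertices are the hyperplanes of type `ε`; two distinct ones are adjacent if their
intersection meets the quadric of `Q` in a degenerate quadric. For a parabolic form `Q` on the space
of dimension `2m + 1` over the field with `q` elements, `q` even, this is the graph
`NO^ε(2m+1,q)`. -/
def oddNO (Q : QuadraticForm K V) (ε : ℤˣ) : SimpleGraph (hyperplanesOfType Q ε) where
  Adj H₁ H₂ := H₁ ≠ H₂ ∧ MeetsDegenerately Q (H₁.1 ⊓ H₂.1)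
  symm := ⟨fun _ _ h => ⟨h.1.symm, by rw [inf_comm]; exact h.2⟩⟩
  loopless := ⟨fun _ h => h.1 rfl⟩

/-- The symplectic two-graph of a quadratic form `Q` over the field with two elements: its vertices
are the vectors `a` with `Q a = 1`, its triples are the `{a, b, c}` with
`⟨a, b⟩ + ⟨a, c⟩ + ⟨b, c⟩ = 0`, where `⟨x, y⟩ = Q (x + y) + Q x + Q y`. For `Q` non-degenerate of
type `±1` in dimension `2m` it is the two-graph `X^±_{2m}`. -/
def symplecticTwoGraph {V : Type*} [AddCommGroup V] [Module (ZMod 2) V]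
    (Q : QuadraticForm (ZMod 2) V) : TwoGraph {a : V // Q a = 1} where
  triples := {t | ∃ a b c : {a : V // Q a = 1}, a ≠ b ∧ a ≠ c ∧ b ≠ c ∧
    (∀ x, x ∈ t ↔ x = a ∨ x = b ∨ x = c) ∧
    QuadraticMap.polar Q a.1 b.1 + QuadraticMap.polar Q a.1 c.1 +
      QuadraticMap.polar Q b.1 c.1 = 0}
  card_eq_three := by
    classical
    rintro t ⟨a, b, c, hab, hac, hbc, ht, -⟩
    exact Finset.card_eq_three.mpr ⟨a, b, c, hab, hac, hbc, by ext w; simp [ht]⟩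
  even_quadruple := by
    classical
    refine even_quadruple_of_symm (fun x y : {a : V // Q a = 1} => QuadraticMap.polar Q x.1 y.1)
      (fun x y => QuadraticMap.polar_comm _ _ _) _ ?_ (fun t => Iff.rfl)
    rintro t ⟨a, b, c, hab, hac, hbc, ht, -⟩
    exact Finset.card_eq_three.mpr ⟨a, b, c, hab, hac, hbc, by ext w; simp [ht]⟩

end QuadraticForms

end PolarTwoGraph

/-! All three statements follow from one normal form, `IsSwitchedOrthogonality`: the vertices are in
bijection with the vectors of value 1 of a binary quadratic form, and adjacency is orthogonality up
to a coboundary `h x + h y`. Around a triple each value of `h` occurs twice and cancels, which gives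
the symplectic two-graph; two graphs in normal form over the same quadratic form differ by a
switching.

In even dimension over the field of order 2, points off the quadric are vectors of value 1. A line
through two of them, `a` and `b`, is tangent exactly when `⟨a,b⟩ = 0`, since then `a + b` is a
singular vector in the radical of the line (`evenNO_adj_iff`). So `h = 0`.

In odd dimension over the field of order 4, let `n` span the nucleus with `P n = 1`, and choose `φ`
with `φ n = 1` and `ker φ` of type `ε`. The hyperplanes off the nucleus are the kernels `H_a` of `φ
+ ⟨a,·⟩` for a unique `a` in `ker φ`. With `ψ = (-1)^Tr`, the exponential sum of `P` on `H_a` is `ψ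
(P a)` times that on `ker φ` (`gaussSum_restrict`), so `H_a` has type `-ε` exactly when `Tr (P a) =
1`. The vertices are thus the vectors of value 1 of the binary form `Tr ∘ P` on `ker φ`, which has
dimension `4m` and type `ε`, because its exponential sum is that of `P`. Put `s = ⟨a,b⟩`. The
bilinear radical of `H_a ∩ H_b` is spanned by `a + b + s n`, of value `P a + P b + s + s²`
(`meetsDegenerately_iff`). Here `s + s²` is `Tr s`, the polar form of `Tr ∘ P`; and with `ω` a fixed
element of trace 1, `P a - ω` lies in the prime field and serves as the coboundary.

Types enter only through exponential sums: for a nondegenerate polar form in dimension `2m` the sum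
is `ε q^m` (`isOfType_iff_gaussSum`), and over the field of order 2 the dimension and this sum
determine the form up to isometry (`exists_isometry_of_gaussSum_eq`). Hence the choice of forms is
immaterial. -/

namespace PolarTwoGraph

/-! ### Alternating forms: symplectic coordinates and parity of the rank. -/

section SymplecticBasis

variable {K : Type*} [Field K]

theorem nondegenerate_of_isRefl_of_ker_eq_bot {V : Type*} [AddCommGroup V] [Module K V]
    {B : LinearMap.BilinForm K V} (hB : B.IsRefl) (h : LinearMap.ker B = ⊥) :
    B.Nondegenerate :=
  hB.nondegenerate_iff_separatingLeft.mpr (LinearMap.separatingLeft_iff_ker_eq_bot.mpr h)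

/-- A nondegenerate alternating form is the standard symplectic form in suitable coordinates. -/
theorem exists_symplectic_coordinates (n : ℕ) {V : Type*} [AddCommGroup V] [Module K V]
    [FiniteDimensional K V] (hn : Module.finrank K V = n)
    (B : LinearMap.BilinForm K V) (hB : B.IsAlt) (hker : LinearMap.ker B = ⊥) :
    ∃ (k : ℕ) (e : V ≃ₗ[K] (Fin k → K × K)), ∀ x y,
      B x y = ∑ i, ((e x i).1 * (e y i).2 - (e x i).2 * (e y i).1) := by
  induction n using Nat.strong_induction_on generalizing V with
  | _ n ih =>
    have hinj : ∀ x, (∀ y, B x y = 0) → x = 0 := fun x hx =>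
      (Submodule.eq_bot_iff _).mp hker x (LinearMap.ext hx)
    rcases subsingleton_or_nontrivial V with hV | hV
    · refine ⟨0, LinearEquiv.ofSubsingleton V (Fin 0 → K × K), fun x y => ?_⟩
      rw [Subsingleton.elim x 0]; simp
    · obtain ⟨v, hv⟩ := exists_ne (0 : V)
      obtain ⟨w', hw'⟩ : ∃ w, B v w ≠ 0 := by
        by_contra! h
        exact hv (hinj v h)
      obtain ⟨w, hw⟩ : ∃ w, B v w = 1 := ⟨(B v w')⁻¹ • w', by simp [hw']⟩
      have hwv : B w v = -1 := by rw [← hB.neg_eq, hw]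
      -- `U` is the orthogonal complement of the hyperbolic pair `v, w`; the induction continues on
      -- it.
      set U : Submodule K V := LinearMap.ker (B v) ⊓ LinearMap.ker (B w) with hU
      have hmemU : ∀ x, x ∈ U ↔ B v x = 0 ∧ B w x = 0 := fun x => Iff.rfl
      have hlt : Module.finrank K U < n := by
        rw [← hn]
        refine Submodule.finrank_lt (fun h => ?_)
        have : w ∈ U := by rw [h]; trivial
        rw [hmemU, hw] at this
        exact one_ne_zero this.1
      have hproj : ∀ x, x - B x w • v + B x v • w ∈ U := by
        intro x
        have h1 := hB.neg_eq v x
        have h2 := hB.neg_eq w x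
        rw [hmemU]
        simp [hw, hwv, hB.self_eq_zero, ← h1, ← h2]
      have hUker : LinearMap.ker (B.restrict U) = ⊥ := by
        rw [Submodule.eq_bot_iff]
        intro x hx
        apply Subtype.ext
        refine hinj _ fun y => ?_
        have h1 := LinearMap.congr_fun hx ⟨_, hproj y⟩
        have h2 := hB.neg_eq v x
        have h3 := hB.neg_eq w x
        have h4 := (hmemU _).mp x.2
        simp only [LinearMap.BilinForm.restrict_apply, LinearMap.zero_apply] at h1
        simp only [LinearMap.domRestrict_apply, map_add, map_sub, map_smul, smul_eq_mul] at h1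
        rw [← h2, ← h3, h4.1, h4.2] at h1
        simpa using h1
      obtain ⟨k, e, he⟩ := ih _ hlt rfl (B.restrict U) (fun x => hB x) hUker
      let p : V →ₗ[K] U := LinearMap.codRestrict U
        (LinearMap.id - (B.flip w).smulRight v + (B.flip v).smulRight w) (fun x => by
          simpa using hproj x)
      have hp : ∀ x, (p x : V) = x - B x w • v + B x v • w := fun x => rfl
      -- The decomposition is `x = B(x,w) v - B(x,v) w + p x`, which supplies the new coordinate
      -- pair.
      let f : V →ₗ[K] (Fin (k + 1) → K × K) := LinearMap.pi (Fin.cons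
        ((B.flip w).prod (-(B.flip v))) (fun i => LinearMap.proj i ∘ₗ e.toLinearMap ∘ₗ p))
      have hf0 : ∀ x, f x 0 = (B x w, -B x v) := fun x => rfl
      have hfs : ∀ x i, f x (Fin.succ i) = e (p x) i := fun x i => rfl
      have hform : ∀ x y,
          B x y = ∑ i, ((f x i).1 * (f y i).2 - (f x i).2 * (f y i).1) := by
        intro x y
        rw [Fin.sum_univ_succ]
        simp only [hf0, hfs]
        rw [← he]
        simp only [LinearMap.BilinForm.restrict_apply, LinearMap.domRestrict_apply, hp]
        have h1 := hB.neg_eq v y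
        have h2 := hB.neg_eq w y
        simp only [map_add, map_sub, map_smul, LinearMap.add_apply, LinearMap.sub_apply,
          LinearMap.smul_apply, smul_eq_mul, hw, hwv, hB.self_eq_zero, ← h1, ← h2]
        ring
      have hfinj : Function.Injective f := by
        rw [← LinearMap.ker_eq_bot, Submodule.eq_bot_iff]
        intro x hx
        refine hinj x fun y => ?_
        rw [hform, LinearMap.mem_ker.mp hx]
        simp
      have hfsurj : Function.Surjective f := by
        intro z
        obtain ⟨u, hu⟩ := e.surjective (fun i => z (Fin.succ i))
        have h4 := (hmemU _).mp u.2
        have h2 := hB.neg_eq v u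
        have h3 := hB.neg_eq w u
        rw [h4.1, neg_zero] at h2
        rw [h4.2, neg_zero] at h3
        refine ⟨(z 0).1 • v + (z 0).2 • w + u, ?_⟩
        have hpu : p ((z 0).1 • v + (z 0).2 • w + u) = u := by
          apply Subtype.ext
          rw [hp]
          simp only [map_add, map_smul, LinearMap.add_apply, LinearMap.smul_apply, smul_eq_mul,
            hw, hwv, hB.self_eq_zero, ← h2, ← h3]
          module
        ext i : 1
        refine Fin.cases ?_ (fun i => ?_) i
        · rw [hf0]
          simp [hw, hwv, hB.self_eq_zero, ← h2, ← h3]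
        · rw [hfs, hpu, hu]
      exact ⟨k + 1, LinearEquiv.ofBijective f ⟨hfinj, hfsurj⟩, hform⟩

theorem finrank_symplectic_coordinates (k : ℕ) :
    Module.finrank K (Fin k → K × K) = 2 * k := by
  rw [Module.finrank_pi_fintype]
  simp [mul_comm]

theorem even_finrank_of_isAlt {V : Type*} [AddCommGroup V] [Module K V]
    [FiniteDimensional K V] (B : LinearMap.BilinForm K V) (hB : B.IsAlt)
    (hker : LinearMap.ker B = ⊥) : Even (Module.finrank K V) := by
  obtain ⟨k, e, -⟩ := exists_symplectic_coordinates _ rfl B hB hker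
  rw [e.finrank_eq, finrank_symplectic_coordinates]
  exact even_two_mul k

/-- A complement of the radical carries a nondegenerate alternating form, so its dimension is even,
and it differs from the sum here by twice the dimension of the radical. -/
theorem even_finrank_add_finrank_ker {V : Type*} [AddCommGroup V] [Module K V]
    [FiniteDimensional K V] (B : LinearMap.BilinForm K V) (hB : B.IsAlt) :
    Even (Module.finrank K V + Module.finrank K (LinearMap.ker B)) := by
  obtain ⟨C, hC⟩ := (LinearMap.ker B).exists_isCompl
  have hCker : LinearMap.ker (B.restrict C) = ⊥ := by
    rw [LinearMap.BilinForm.ker_restrict_eq_of_codisjoint hC.symm.codisjoint]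
    · rw [Submodule.eq_bot_iff]
      exact fun x hx => Subtype.ext (Submodule.disjoint_def.mp hC.disjoint _ hx x.2)
    · intro x _ y hy
      rw [← hB.neg_eq, LinearMap.mem_ker.mp hy]; simp
  have h1 := even_finrank_of_isAlt (B.restrict C) (fun x => hB x) hCker
  have h2 := Submodule.finrank_add_eq_of_isCompl hC
  grind

theorem exists_linearEquiv_of_isAlt {V W : Type*} [AddCommGroup V] [Module K V]
    [FiniteDimensional K V] [AddCommGroup W] [Module K W] [FiniteDimensional K W]
    (h : Module.finrank K V = Module.finrank K W)
    (B : LinearMap.BilinForm K V) (hB : B.IsAlt) (hker : LinearMap.ker B = ⊥)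
    (C : LinearMap.BilinForm K W) (hC : C.IsAlt) (hker' : LinearMap.ker C = ⊥) :
    ∃ e : V ≃ₗ[K] W, ∀ x y, C (e x) (e y) = B x y := by
  obtain ⟨k, f, hf⟩ := exists_symplectic_coordinates _ rfl B hB hker
  obtain ⟨l, g, hg⟩ := exists_symplectic_coordinates _ rfl C hC hker'
  obtain rfl : k = l := by
    rw [f.finrank_eq, g.finrank_eq, finrank_symplectic_coordinates,
      finrank_symplectic_coordinates] at h
    omega
  exact ⟨f.trans g.symm, fun x y => by simp [hf, hg]⟩

end SymplecticBasis

/-! ### Exponential sums of quadratic forms and the Witt index. -/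

section GaussSums

variable {K V : Type*} [Field K] [AddCommGroup V] [Module K V]

/-- The exponential sum of a quadratic form with respect to an additive character. -/
noncomputable def gaussSum (ψ : AddChar K ℤ) (Q : V → K) : ℤ := ∑ᶠ x, ψ (Q x)

theorem sum_addChar_mul [Fintype K] (ψ : AddChar K ℤ) (hψ : ψ ≠ 1) (b : K) [Decidable (b = 0)] :
    ∑ c, ψ (c * b) = if b = 0 then (Fintype.card K : ℤ) else 0 := by
  classical
  rw [AddChar.sum_mulShift b (AddChar.IsPrimitive.of_ne_one hψ)]
  simp

theorem sum_addChar_linear [Fintype V] (ψ : AddChar K ℤ) (hψ : ψ ≠ 1) (f : V →ₗ[K] K)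
    [Decidable (f = 0)] :
    ∑ x, ψ (f x) = if f = 0 then (Fintype.card V : ℤ) else 0 := by
  split_ifs with h
  · simp [h]
  · have := AddChar.sum_eq_zero_of_ne_one (ψ := ψ.compAddMonoidHom f.toAddMonoidHom) (fun h1 => by
      obtain ⟨c, hc⟩ := AddChar.ne_one_iff.mp hψ
      obtain ⟨v, hv⟩ : ∃ v, f v ≠ 0 := by
        by_contra! h2
        exact h (LinearMap.ext h2)
      apply hc
      have h3 := DFunLike.congr_fun h1 ((c / f v) • v)
      simpa [hv] using h3)
    simpa using this

theorem IsOfType.nondegenerate {Q : QuadraticForm K V} {ε : ℤˣ} (h : IsOfType Q ε) :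
    Q.Nondegenerate := by
  unfold IsOfType at h
  split_ifs at h
  exacts [h.1, h.1]

theorem polarBilin_comm (Q : QuadraticForm K V) (x y : V) :
    Q.polarBilin x y = Q.polarBilin y x := by
  simp only [QuadraticMap.polarBilin_apply_apply, QuadraticMap.polar_comm Q x y]

theorem map_add_eq_add_polarBilin (Q : QuadraticForm K V) (x y : V) :
    Q (x + y) = Q x + Q y + Q.polarBilin x y := by
  rw [QuadraticMap.polarBilin_apply_apply, QuadraticMap.polar]; ring

theorem le_orthogonal_of_singular (Q : QuadraticForm K V) {W : Submodule K V}
    (hW : ∀ x ∈ W, Q x = 0) : W ≤ LinearMap.BilinForm.orthogonal Q.polarBilin W := by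
  intro x hx
  rw [LinearMap.BilinForm.mem_orthogonal_iff]
  intro y hy
  have := map_add_eq_add_polarBilin Q y x
  rw [hW _ hx, hW _ hy, hW _ (W.add_mem hy hx)] at this
  simpa using this.symm

/-- The exponential sum is concentrated on the orthogonal of a totally singular subspace. -/
theorem gaussSum_eq_sum_orthogonal (ψ : AddChar K ℤ) (hψ : ψ ≠ 1) (Q : QuadraticForm K V)
    (W : Submodule K V) (hW : ∀ x ∈ W, Q x = 0) [Fintype V]
    [DecidablePred (· ∈ LinearMap.BilinForm.orthogonal Q.polarBilin W)] :
    gaussSum ψ Q = ∑ x with x ∈ LinearMap.BilinForm.orthogonal Q.polarBilin W, ψ (Q x) := by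
  classical
  let _ := Fintype.ofFinite W
  have hcard : (Fintype.card W : ℤ) ≠ 0 := by exact_mod_cast Fintype.card_ne_zero
  apply mul_left_cancel₀ hcard
  rw [gaussSum, finsum_eq_sum_of_fintype, Finset.sum_filter]
  -- Average over translations by `W`: the inner sum over `w` of `ψ ⟨x,w⟩` vanishes unless `x` is
  -- orthogonal to `W`.
  calc (Fintype.card W : ℤ) * ∑ x, ψ (Q x) = ∑ w : W, ∑ x, ψ (Q (x + w)) := by
        rw [← smul_eq_mul, ← Finset.card_univ, Nat.cast_smul_eq_nsmul, ← Finset.sum_const]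
        exact Finset.sum_congr rfl fun w _ =>
          (Equiv.sum_comp (Equiv.addRight (w : V)) (fun x => ψ (Q x))).symm
    _ = ∑ x, ψ (Q x) * ∑ w : W, ψ ((Q.polarBilin x).domRestrict W w) := by
        rw [Finset.sum_comm]
        refine Finset.sum_congr rfl fun x _ => ?_
        rw [Finset.mul_sum]
        refine Finset.sum_congr rfl fun w _ => ?_
        rw [map_add_eq_add_polarBilin, hW _ w.2, add_zero, AddChar.map_add_eq_mul, LinearMap.domRestrict_apply]
    _ = _ := by
        rw [Finset.mul_sum]
        refine Finset.sum_congr rfl fun x _ => ?_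
        rw [sum_addChar_linear ψ hψ]
        have : (Q.polarBilin x).domRestrict W = 0 ↔
            x ∈ LinearMap.BilinForm.orthogonal Q.polarBilin W := by
          rw [LinearMap.BilinForm.mem_orthogonal_iff, LinearMap.ext_iff, Subtype.forall]
          exact forall₂_congr fun w _ => by rw [polarBilin_comm Q w x]; rfl
        by_cases h : x ∈ LinearMap.BilinForm.orthogonal Q.polarBilin W <;> simp [this, h, mul_comm]

/-- The Witt index is attained by a totally singular subspace that contains every singular
vector orthogonal to it. -/
theorem exists_wittIndex_subspace [FiniteDimensional K V] (Q : QuadraticForm K V) :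
    ∃ W : Submodule K V, (∀ x ∈ W, Q x = 0) ∧ Module.finrank K W = wittIndex Q ∧
      ∀ x ∈ LinearMap.BilinForm.orthogonal Q.polarBilin W, Q x = 0 → x ∈ W := by
  have hbdd : BddAbove {d | ∃ W : Submodule K V, (∀ x ∈ W, Q x = 0) ∧ Module.finrank K W = d} :=
    ⟨Module.finrank K V, by rintro _ ⟨W, -, rfl⟩; exact Submodule.finrank_le W⟩
  obtain ⟨W, hW, hWr⟩ := Nat.sSup_mem (s := {d | ∃ W : Submodule K V,
    (∀ x ∈ W, Q x = 0) ∧ Module.finrank K W = d}) ⟨0, ⊥, by simp, by simp⟩ hbdd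
  refine ⟨W, hW, hWr, fun x hx hQ => ?_⟩
  by_contra hxW
  have hsing : ∀ y ∈ W ⊔ Submodule.span K {x}, Q y = 0 := by
    intro y hy
    obtain ⟨w, hw, z, hz, rfl⟩ := Submodule.mem_sup.mp hy
    obtain ⟨c, rfl⟩ := Submodule.mem_span_singleton.mp hz
    rw [map_add_eq_add_polarBilin, hW w hw, QuadraticMap.map_smul, hQ, map_smul,
      LinearMap.BilinForm.mem_orthogonal_iff.mp hx w hw]
    simp
  have hle : Module.finrank K ↥(W ⊔ Submodule.span K {x}) ≤ Module.finrank K W := by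
    rw [hWr]
    exact le_csSup hbdd ⟨_, hsing, rfl⟩
  have heq := Submodule.eq_of_le_of_finrank_le (le_sup_left : W ≤ W ⊔ Submodule.span K {x}) hle
  apply hxW
  rw [heq]
  exact Submodule.mem_sup_right (Submodule.mem_span_singleton_self x)

variable [CharP K 2]

theorem polarBilin_isAlt (Q : QuadraticForm K V) :
    LinearMap.BilinForm.IsAlt Q.polarBilin := fun x => by
  rw [QuadraticMap.polarBilin_apply_apply, QuadraticMap.polar_self, CharTwo.two_nsmul]

theorem addChar_mul_self (ψ : AddChar K ℤ) (x : K) : ψ x * ψ x = 1 := by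
  rw [← AddChar.map_add_eq_mul, CharTwo.add_self_eq_zero, AddChar.map_zero_eq_one]

variable [FiniteDimensional K V]

/-- Non-degeneracy bounds the dimension of the radical by 1, and parity then excludes 1. -/
theorem ker_polarBilin_eq_bot {Q : QuadraticForm K V} (hQ : Q.Nondegenerate)
    (hV : Even (Module.finrank K V)) : LinearMap.ker Q.polarBilin = ⊥ := by
  have h1 := even_finrank_add_finrank_ker _ (polarBilin_isAlt Q)
  have h2 := Module.finrank_le_of_rank_le (n := 1) (by simpa using hQ.rank_rad_polar_le)
  rw [Nat.even_add, iff_true_left hV] at h1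
  rw [← Submodule.finrank_eq_zero (R := K)]
  obtain ⟨k, hk⟩ := h1
  omega

variable [Fintype K]

/-- The square of the exponential sum. -/
theorem gaussSum_mul_self (ψ : AddChar K ℤ) (hψ : ψ ≠ 1) (Q : QuadraticForm K V)
    (hker : LinearMap.ker Q.polarBilin = ⊥) :
    gaussSum ψ Q * gaussSum ψ Q = (Fintype.card K : ℤ) ^ Module.finrank K V := by
  classical
  have : Finite V := Module.finite_of_finite K
  let _ := Fintype.ofFinite V
  rw [gaussSum, finsum_eq_sum_of_fintype, Finset.sum_mul_sum]
  -- Substitute `y = x + z`; the factor `ψ (Q x)` appears squared and is 1 in characteristic two.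
  calc ∑ x, ∑ y, ψ (Q x) * ψ (Q y) = ∑ x, ∑ z, ψ (Q z) * ψ (Q.polarBilin z x) := by
        refine Finset.sum_congr rfl fun x _ => ?_
        rw [← Equiv.sum_comp (Equiv.addLeft x)]
        refine Finset.sum_congr rfl fun z _ => ?_
        rw [Equiv.coe_addLeft, map_add_eq_add_polarBilin, AddChar.map_add_eq_mul, AddChar.map_add_eq_mul,
          polarBilin_comm Q z x, ← mul_assoc, ← mul_assoc, addChar_mul_self, one_mul]
    _ = ∑ z, ψ (Q z) * ∑ x, ψ (Q.polarBilin z x) := by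
        rw [Finset.sum_comm]
        simp only [Finset.mul_sum]
    _ = ∑ z : V, if z = 0 then (Fintype.card V : ℤ) else 0 := by
        refine Finset.sum_congr rfl fun z _ => ?_
        rw [sum_addChar_linear ψ hψ]
        have : Q.polarBilin z = 0 ↔ z = 0 := by
          rw [← LinearMap.mem_ker, hker, Submodule.mem_bot]
        by_cases hz : z = 0 <;> simp [this, hz]
    _ = _ := by
        rw [Finset.sum_ite_eq' Finset.univ 0, if_pos (Finset.mem_univ _),
          Module.card_eq_pow_finrank (K := K)]
        push_cast; rfl

/-- Every nonzero scalar is a square, so replacing `ψ` by `ψ (c * ·)` with `c ≠ 0` does not change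
the sum. Summing over these `c` counts the singular vectors of the orthogonal of `W`, which by
maximality are those of `W`. -/
theorem card_sub_one_mul_gaussSum (ψ : AddChar K ℤ) (hψ : ψ ≠ 1) (Q : QuadraticForm K V)
    (W : Submodule K V) (hW : ∀ x ∈ W, Q x = 0)
    (hmax : ∀ x ∈ LinearMap.BilinForm.orthogonal Q.polarBilin W, Q x = 0 → x ∈ W) :
    ((Fintype.card K : ℤ) - 1) * gaussSum ψ Q =
      Nat.card K * Nat.card W - Nat.card (LinearMap.BilinForm.orthogonal Q.polarBilin W) := by
  classical
  have : Finite V := Module.finite_of_finite K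
  let _ := Fintype.ofFinite V
  set U := LinearMap.BilinForm.orthogonal Q.polarBilin W with hU
  have hWU : W ≤ U := le_orthogonal_of_singular Q hW
  have hS := gaussSum_eq_sum_orthogonal ψ hψ Q W hW
  rw [← hU] at hS
  have hscale : ∀ c : K, c ≠ 0 → gaussSum ψ Q = ∑ x with x ∈ U, ψ (c * Q x) := by
    intro c hc
    obtain ⟨d, rfl⟩ := FiniteField.isSquare_of_char_two (ringChar.eq K 2) c
    have hd : d ≠ 0 := fun h => hc (by simp [h])
    rw [hS]
    refine (Finset.sum_bij (fun x _ => d • x) ?_ ?_ ?_ ?_).symm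
    · intro x hx
      simp only [Finset.mem_filter, Finset.mem_univ, true_and] at hx ⊢
      exact U.smul_mem d hx
    · intro x _ y _ h
      exact smul_right_injective V hd h
    · intro y hy
      simp only [Finset.mem_filter, Finset.mem_univ, true_and] at hy
      exact ⟨d⁻¹ • y, by simpa using U.smul_mem _ hy, by simp [hd]⟩
    · intro x _
      rw [QuadraticMap.map_smul, smul_eq_mul]
  -- The full sum over `c` detects `Q x = 0`; the subtracted 1 is the term `c = 0`.
  have hsum : ∑ c : K, (if c = 0 then 0 else gaussSum ψ Q) =
      ∑ x with x ∈ U, ((if Q x = 0 then (Fintype.card K : ℤ) else 0) - 1) := by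
    simp only [← sum_addChar_mul ψ hψ]
    rw [Finset.sum_sub_distrib, Finset.sum_comm, ← Finset.add_sum_erase _ _ (Finset.mem_univ 0),
      ← Finset.add_sum_erase Finset.univ (fun c => ∑ x with x ∈ U, ψ (c * Q x))
        (Finset.mem_univ 0)]
    simp only [zero_mul, AddChar.map_zero_eq_one, if_true, add_sub_cancel_left, zero_add]
    refine Finset.sum_congr rfl fun c hc => ?_
    rw [if_neg (Finset.ne_of_mem_erase hc), hscale c (Finset.ne_of_mem_erase hc)]
  have hL : ∑ c : K, (if c = 0 then 0 else gaussSum ψ Q) =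
      ((Fintype.card K : ℤ) - 1) * gaussSum ψ Q := by
    have : ∀ c : K, (if c = 0 then 0 else gaussSum ψ Q) =
        gaussSum ψ Q - if c = 0 then gaussSum ψ Q else 0 := fun c => by split_ifs <;> simp
    simp only [this, Finset.sum_sub_distrib, Finset.sum_ite_eq', Finset.mem_univ, if_true,
      Finset.sum_const, Finset.card_univ, nsmul_eq_mul]
    ring
  rw [← hL, hsum, Finset.sum_sub_distrib, ← Finset.sum_filter, Finset.filter_filter,
    Finset.sum_const, Finset.sum_const]
  have h1 : (Finset.univ.filter fun x => x ∈ U ∧ Q x = 0).card = Nat.card W := by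
    rw [← Fintype.card_subtype, ← Nat.card_eq_fintype_card]
    exact Nat.card_congr (Equiv.subtypeEquivRight fun x =>
      ⟨fun h => hmax x h.1 h.2, fun h => ⟨hWU h, hW x h⟩⟩)
  have h2 : (Finset.univ.filter fun x => x ∈ U).card = Nat.card U := by
    rw [← Fintype.card_subtype, ← Nat.card_eq_fintype_card]
  rw [h1, h2, Nat.card_eq_fintype_card (α := K)]
  simp [mul_comm]

/-- With `w` the Witt index, `j = m - w` and `S` the sum, `(q - 1) S = q^(w+1) - q^(w+2j)` while `S²
= q^(2m)`. For `j ≥ 2` the right side is too negative for `S ≥ -q^(w+j)`. -/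
theorem finrank_eq_and_gaussSum (ψ : AddChar K ℤ) (hψ : ψ ≠ 1) (Q : QuadraticForm K V)
    (hker : LinearMap.ker Q.polarBilin = ⊥) {m : ℕ} (hm : Module.finrank K V = 2 * m) :
    (m = wittIndex Q ∧ gaussSum ψ Q = (Fintype.card K : ℤ) ^ m) ∨
      (m = wittIndex Q + 1 ∧ gaussSum ψ Q = -(Fintype.card K : ℤ) ^ m) := by
  obtain ⟨W, hW, hWr, hmax⟩ := exists_wittIndex_subspace Q
  have hnd := nondegenerate_of_isRefl_of_ker_eq_bot (polarBilin_isAlt Q).isRefl hker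
  have h1 := card_sub_one_mul_gaussSum ψ hψ Q W hW hmax
  have h2 := gaussSum_mul_self ψ hψ Q hker
  have h3 := LinearMap.BilinForm.finrank_orthogonal hnd W
  have h4 : Module.finrank K W ≤ Module.finrank K V := Submodule.finrank_le W
  rw [Module.natCard_eq_pow_finrank (K := K) (V := W), Module.natCard_eq_pow_finrank (K := K)
    (V := LinearMap.BilinForm.orthogonal Q.polarBilin W), h3, hWr, hm,
    Nat.card_eq_fintype_card] at h1
  rw [hm] at h2
  rw [hWr, hm] at h4
  have hWU : Module.finrank K W ≤ Module.finrank K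
      (LinearMap.BilinForm.orthogonal Q.polarBilin W) :=
    Submodule.finrank_mono (le_orthogonal_of_singular Q hW)
  rw [h3, hWr, hm] at hWU
  have hq : (1 : ℤ) < Fintype.card K := by exact_mod_cast Fintype.one_lt_card
  push_cast at h1
  generalize (Fintype.card K : ℤ) = q at *
  generalize gaussSum ψ Q = S at *
  generalize wittIndex Q = w at *
  obtain ⟨j, rfl⟩ : ∃ j, m = w + j := ⟨m - w, by omega⟩
  rw [show 2 * (w + j) - w = w + 2 * j by omega] at h1
  have hq1 : q - 1 ≠ 0 := by omega
  match j with
  | 0 =>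
    left
    refine ⟨rfl, mul_left_cancel₀ hq1 ?_⟩
    rw [h1]; ring
  | 1 =>
    right
    refine ⟨rfl, mul_left_cancel₀ hq1 ?_⟩
    rw [h1]; ring
  | j + 2 =>
    exfalso
    have hS : -q ^ (w + (j + 2)) ≤ S := by
      rw [two_mul, pow_add] at h2
      rcases mul_self_eq_mul_self_iff.mp h2 with h | h
      · rw [h]
        have : 0 < q ^ (w + (j + 2)) := by positivity
        omega
      · rw [h]
    have h5 : q * q ^ w < q ^ (w + (j + 2)) := by
      rw [← pow_succ']
      exact pow_lt_pow_right₀ hq (by omega)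
    have h6 : q * q ^ (w + (j + 2)) ≤ q ^ (w + 2 * (j + 2)) := by
      rw [← pow_succ']
      exact pow_le_pow_right₀ hq.le (by omega)
    nlinarith

/-- This turns each later question about types into a comparison of signs of exponential sums, for
any nontrivial integer-valued character. -/
theorem isOfType_iff_gaussSum (ψ : AddChar K ℤ) (hψ : ψ ≠ 1) (Q : QuadraticForm K V)
    (hker : LinearMap.ker Q.polarBilin = ⊥) {m : ℕ} (hm : Module.finrank K V = 2 * m) (ε : ℤˣ) :
    IsOfType Q ε ↔ gaussSum ψ Q = ε * (Fintype.card K : ℤ) ^ m := by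
  have hnd : Q.Nondegenerate :=
    ⟨le_bot_iff.mp (hker ▸ QuadraticMap.radical_le_ker_polarBilin), by rw [hker]; simp⟩
  have hpos : 0 < (Fintype.card K : ℤ) ^ m := by
    have : 0 < (Fintype.card K : ℤ) := by exact_mod_cast Fintype.card_pos
    positivity
  have hne : (-1 : ℤˣ) ≠ 1 := by decide
  rcases finrank_eq_and_gaussSum ψ hψ Q hker hm with ⟨h1, h2⟩ | ⟨h1, h2⟩ <;>
    rcases Int.units_eq_one_or ε with rfl | rfl <;>
    simp only [IsOfType, IsHyperbolic, IsElliptic, hnd, true_and, if_true, if_neg hne, h2, hm,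
      Units.val_one, Units.val_neg] <;> constructor <;> intro h <;> omega

end GaussSums

/-! ### Classification of nondegenerate forms over the field of order 2. -/

section BinaryForms

/-- The nontrivial additive character of the field with two elements. -/
def signChar : AddChar (ZMod 2) ℤ where
  toFun t := if t = 0 then 1 else -1
  map_zero_eq_one' := rfl
  map_add_eq_mul' := by decide

theorem signChar_apply (t : ZMod 2) : signChar t = if t = 0 then 1 else -1 := rfl

theorem signChar_ne_one : signChar ≠ 1 :=
  AddChar.ne_one_iff.mpr ⟨1, by decide⟩

/-- Nondegenerate quadratic forms over the field with two elements are classified by the dimension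
and the exponential sum. -/
theorem exists_isometry_of_gaussSum_eq {V W : Type*} [AddCommGroup V] [Module (ZMod 2) V]
    [FiniteDimensional (ZMod 2) V] [AddCommGroup W] [Module (ZMod 2) W]
    [FiniteDimensional (ZMod 2) W] (Q : QuadraticForm (ZMod 2) V) (R : QuadraticForm (ZMod 2) W)
    (hQ : LinearMap.ker Q.polarBilin = ⊥) (hR : LinearMap.ker R.polarBilin = ⊥)
    (h : Module.finrank (ZMod 2) V = Module.finrank (ZMod 2) W)
    (hS : gaussSum signChar Q = gaussSum signChar R) :
    ∃ e : V ≃ₗ[ZMod 2] W, ∀ x, R (e x) = Q x := by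
  obtain ⟨e, he⟩ := exists_linearEquiv_of_isAlt h _ (polarBilin_isAlt Q) hQ _
    (polarBilin_isAlt R) hR
  -- After a symplectic identification both forms have the same polarization, so their sum is
  -- additive and equals `⟨a,·⟩` for some `a`.
  let D : V →+ ZMod 2 :=
    { toFun := fun x => R (e x) + Q x
      map_zero' := by simp
      map_add' := fun x y => by
        rw [map_add, map_add_eq_add_polarBilin, map_add_eq_add_polarBilin, he]
        linear_combination CharTwo.add_self_eq_zero (Q.polarBilin x y) }
  have hnd := nondegenerate_of_isRefl_of_ker_eq_bot (polarBilin_isAlt Q).isRefl hQ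
  obtain ⟨a, ha⟩ := (LinearMap.BilinForm.toDual Q.polarBilin hnd).surjective (D.toZModLinearMap 2)
  have hRe : ∀ x, R (e x) = Q x + Q.polarBilin a x := by
    intro x
    rw [← LinearMap.BilinForm.toDual_def hnd, ha]
    change _ = Q x + (R (e x) + Q x)
    linear_combination -CharTwo.add_self_eq_zero (Q x)
  -- Completing the square, `Q x + ⟨a,x⟩ = Q (x + a) + Q a`. Equality of the nonzero sums will force
  -- `Q a = 0`.
  have hSa : gaussSum signChar R = signChar (Q a) * gaussSum signChar Q := by
    have : Finite V := Module.finite_of_finite (ZMod 2)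
    have : Finite W := Module.finite_of_finite (ZMod 2)
    let _ := Fintype.ofFinite V
    let _ := Fintype.ofFinite W
    simp only [gaussSum, finsum_eq_sum_of_fintype]
    rw [← Equiv.sum_comp e.toEquiv, ← Equiv.sum_comp (Equiv.addRight a) (fun x => signChar (Q x)),
      Finset.mul_sum]
    refine Finset.sum_congr rfl fun x _ => ?_
    rw [Equiv.coe_addRight, map_add_eq_add_polarBilin, ← AddChar.map_add_eq_mul, polarBilin_comm Q x a]
    congr 1
    change R (e x) = _
    rw [hRe]
    linear_combination -CharTwo.add_self_eq_zero (Q a)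
  have hne : gaussSum signChar Q ≠ 0 := by
    intro h0
    have := gaussSum_mul_self signChar signChar_ne_one Q hQ
    rw [h0, zero_mul] at this
    exact pow_ne_zero _ (by simp) this.symm
  have hQa : Q a = 0 := by
    by_contra hQa
    rw [signChar_apply, if_neg hQa, ← hS] at hSa
    omega
  have haa : Q.polarBilin a a = 0 := polarBilin_isAlt Q a
  -- As `Q a = 0`, this transvection changes `Q x` by `⟨a,x⟩² = ⟨a,x⟩`, exactly the discrepancy
  -- between the two forms.
  let τ : V →ₗ[ZMod 2] V := LinearMap.id + (Q.polarBilin a).smulRight a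
  have hτ : ∀ x, τ x = x + Q.polarBilin a x • a := fun x => rfl
  have hinv : Function.Involutive τ := by
    intro x
    rw [hτ, hτ, map_add, map_smul, haa, smul_zero, add_zero, add_assoc, ← add_smul,
      CharTwo.add_self_eq_zero, zero_smul, add_zero]
  have hQτ : ∀ x, Q (τ x) = R (e x) := by
    intro x
    rw [hτ, map_add_eq_add_polarBilin, QuadraticMap.map_smul, hQa, smul_zero, add_zero, map_smul,
      polarBilin_comm Q x a, hRe, smul_eq_mul]
    congr 1
    generalize Q.polarBilin a x = t
    revert t; decide
  refine ⟨(LinearEquiv.ofInvolutive τ hinv).trans e, fun x => ?_⟩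
  change R (e (τ x)) = Q x
  rw [← hQτ, hinv]

end BinaryForms

/-! ### Switching and two-graphs via functions on pairs with values mod 2. -/

section TwoGraphCriteria

variable {X Y : Type*}

/-- A bijection that respects distinct triples is an isomorphism of two-graphs. -/
def TwoGraph.Iso.ofEquiv [DecidableEq X] [DecidableEq Y] {S : TwoGraph X} {T : TwoGraph Y}
    (e : X ≃ Y)
    (h : ∀ a b c : X, a ≠ b → a ≠ c → b ≠ c →
      (({e a, e b, e c} : Finset Y) ∈ T.triples ↔ ({a, b, c} : Finset X) ∈ S.triples)) :
    TwoGraph.Iso S T where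
  toEquiv := e
  map_mem_iff t := by
    by_cases ht : t.card = 3
    · obtain ⟨a, b, c, hab, hac, hbc, rfl⟩ := Finset.card_eq_three.mp ht
      rw [← h a b c hab hac hbc]
      simp
    · refine iff_of_false (fun h1 => ht ?_) (fun h1 => ht (S.card_eq_three _ h1))
      simpa using T.card_eq_three _ h1

/-- Here `χ` marks the non-edges; among three pairs, the number of edges is odd exactly when that of
non-edges is even. -/
theorem mem_associatedTwoGraph_iff [DecidableEq X] (G : SimpleGraph X) (χ : X → X → ZMod 2)
    (hχ : ∀ a b, a ≠ b → (G.Adj a b ↔ χ a b = 0)) {a b c : X} (hab : a ≠ b) (hac : a ≠ c)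
    (hbc : b ≠ c) :
    ({a, b, c} : Finset X) ∈ (associatedTwoGraph G).triples ↔ χ a b + χ a c + χ b c = 0 := by
  classical
  have h3 : ({a, b, c} : Finset X).card = 3 :=
    Finset.card_eq_three.mpr ⟨a, b, c, hab, hac, hbc, rfl⟩
  refine (and_iff_right h3).trans ?_
  rw [ncard_edgeSet_induce_triple G hab hac hbc]
  simp only [hχ a b hab, hχ a c hac, hχ b c hbc]
  generalize χ a b = x
  generalize χ a c = y
  generalize χ b c = z
  revert x y z
  decide

variable {V : Type*} [AddCommGroup V] [Module (ZMod 2) V]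

theorem mem_symplecticTwoGraph_iff [DecidableEq V] (Q : QuadraticForm (ZMod 2) V)
    {a b c : {a : V // Q a = 1}} (hab : a ≠ b) (hac : a ≠ c) (hbc : b ≠ c) :
    ({a, b, c} : Finset {a : V // Q a = 1}) ∈ (symplecticTwoGraph Q).triples ↔
      Q.polarBilin a.1 b.1 + Q.polarBilin a.1 c.1 + Q.polarBilin b.1 c.1 = 0 := by
  rw [← mem_triple_iff (fun a b : {a : V // Q a = 1} => Q.polarBilin a.1 b.1)
    (fun a b => polarBilin_comm Q a.1 b.1) hab hac hbc]
  simp only [symplecticTwoGraph, Set.mem_ofPred_eq, Finset.ext_iff, Finset.mem_insert,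
    Finset.mem_singleton]
  rfl

/-- The graph `G` represents, up to switching, the orthogonality graph on the vectors `a` with
`Q a = 1`. -/
def IsSwitchedOrthogonality (Q : QuadraticForm (ZMod 2) V) (G : SimpleGraph X) : Prop :=
  ∃ (f : X ≃ {a : V // Q a = 1}) (h : X → ZMod 2), ∀ x y, x ≠ y →
    (G.Adj x y ↔ Q.polarBilin (f x).1 (f y).1 + (h x + h y) = 0)

theorem IsSwitchedOrthogonality.nonempty_iso {Q : QuadraticForm (ZMod 2) V} {G : SimpleGraph X}
    (hG : IsSwitchedOrthogonality Q G) :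
    Nonempty (TwoGraph.Iso (associatedTwoGraph G) (symplecticTwoGraph Q)) := by
  classical
  obtain ⟨f, h, hf⟩ := hG
  refine ⟨TwoGraph.Iso.ofEquiv f fun a b c hab hac hbc => ?_⟩
  rw [mem_associatedTwoGraph_iff G _ hf hab hac hbc, mem_symplecticTwoGraph_iff Q
    (f.injective.ne hab) (f.injective.ne hac) (f.injective.ne hbc)]
  generalize Q.polarBilin (f a).1 (f b).1 = x
  generalize Q.polarBilin (f a).1 (f c).1 = y
  generalize Q.polarBilin (f b).1 (f c).1 = z
  generalize h a = x'
  generalize h b = y'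
  generalize h c = z'
  revert x y z x' y' z'
  decide

theorem IsSwitchedOrthogonality.switchingEquivalent {Q : QuadraticForm (ZMod 2) V}
    {G : SimpleGraph X} {H : SimpleGraph Y} (hG : IsSwitchedOrthogonality Q G)
    (hH : IsSwitchedOrthogonality Q H) : SwitchingEquivalent G H := by
  obtain ⟨f, h, hf⟩ := hG
  obtain ⟨g, k, hg⟩ := hH
  -- The two adjacency functions differ by the coboundary of `h + k`, so switch with respect to a
  -- level set of this sum.
  refine ⟨{x | h x + k (g.symm (f x)) = 0}, ⟨⟨f.trans g.symm, fun {x y} => ?_⟩⟩⟩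
  rcases eq_or_ne x y with rfl | hxy
  · simp
  have hxy' : g.symm (f x) ≠ g.symm (f y) := fun h1 => hxy (f.injective (g.symm.injective h1))
  simp only [Equiv.trans_apply, seidelSwitch, Set.mem_ofPred_eq, hf x y hxy, hg _ _ hxy',
    Equiv.apply_symm_apply]
  generalize k (g.symm (f x)) = x'
  generalize k (g.symm (f y)) = y'
  generalize Q.polarBilin (f x).1 (f y).1 = z
  generalize h x = x
  generalize h y = y
  revert x y z x' y'
  decide

end TwoGraphCriteria

/-! ### The graphs on points off a quadric over the field of order 2. -/

section EvenDimension

variable {V : Type*} [AddCommGroup V] [Module (ZMod 2) V]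

theorem zmod_two_ne_zero_iff {t : ZMod 2} : t ≠ 0 ↔ t = 1 := by
  revert t; decide

theorem notMem_quadric_iff (Q : QuadraticForm (ZMod 2) V) (p : Projectivization (ZMod 2) V) :
    p ∉ quadric Q ↔ Q p.rep = 1 := by
  rw [← zmod_two_ne_zero_iff, not_iff_not]
  change (∀ v ∈ p.submodule, Q v = 0) ↔ _
  rw [p.submodule_eq]
  refine ⟨fun h => h _ (Submodule.mem_span_singleton_self _), fun h v hv => ?_⟩
  obtain ⟨c, rfl⟩ := Submodule.mem_span_singleton.mp hv
  rw [QuadraticMap.map_smul, h, smul_zero]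

theorem rep_mk_zmod_two {v : V} (hv : v ≠ 0) : (Projectivization.mk (ZMod 2) v hv).rep = v := by
  obtain ⟨c, hc⟩ := Projectivization.exists_smul_eq_mk_rep (ZMod 2) v hv
  rw [← hc, Subsingleton.elim c 1, one_smul]

/-- Over the field with two elements the points off the quadric are the vectors of value one. -/
noncomputable def evenVertexEquiv (Q : QuadraticForm (ZMod 2) V) :
    {p : Projectivization (ZMod 2) V // p ∉ quadric Q} ≃ {a : V // Q a = 1} where
  toFun p := ⟨p.1.rep, (notMem_quadric_iff Q p.1).mp p.2⟩
  invFun a := ⟨Projectivization.mk (ZMod 2) a.1 (fun h => by simpa [h] using a.2), by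
    rw [notMem_quadric_iff, rep_mk_zmod_two, a.2]⟩
  left_inv p := Subtype.ext p.1.mk_rep
  right_inv a := Subtype.ext (rep_mk_zmod_two _)

theorem restrict_polarBilin {K V : Type*} [Field K] [AddCommGroup V] [Module K V]
    (Q : QuadraticForm K V) (L : Submodule K V) (x y : L) :
    (Q.restrict L).polarBilin x y = Q.polarBilin x.1 y.1 := rfl

/-- If the two vectors are not orthogonal, the alternating form on the line is nonzero, and by
parity its radical is trivial. If they are, their sum is a nonzero singular vector of the radical of
the line they span. -/
theorem evenNO_adj_iff (Q : QuadraticForm (ZMod 2) V)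
    {p r : {p : Projectivization (ZMod 2) V // p ∉ quadric Q}} (hpr : p ≠ r) :
    (evenNO Q).Adj p r ↔ Q.polarBilin p.1.rep r.1.rep = 0 := by
  have hp := (notMem_quadric_iff Q p.1).mp p.2
  have hr := (notMem_quadric_iff Q r.1).mp r.2
  have hne : p.1.rep ≠ r.1.rep := fun h =>
    hpr ((evenVertexEquiv Q).injective (Subtype.ext h))
  change p ≠ r ∧ _ ↔ _
  rw [and_iff_right hpr]
  simp only [Projectivization.submodule_eq, Submodule.span_singleton_le_iff_mem]
  constructor
  · rintro ⟨L, hL, hpL, hrL, hdeg⟩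
    by_contra hB
    apply hdeg
    have : FiniteDimensional (ZMod 2) L := Module.finite_of_finrank_pos (by omega)
    have h1 := even_finrank_add_finrank_ker _ (polarBilin_isAlt (Q.restrict L))
    have h2 : Module.finrank (ZMod 2) (LinearMap.ker (Q.restrict L).polarBilin) <
        Module.finrank (ZMod 2) L := by
      refine Submodule.finrank_lt fun h => hB ?_
      have h3 : (⟨p.1.rep, hpL⟩ : L) ∈ LinearMap.ker (Q.restrict L).polarBilin := by
        rw [h]; trivial
      exact LinearMap.congr_fun h3 (⟨r.1.rep, hrL⟩ : L)
    rw [hL] at h1 h2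
    have hker : LinearMap.ker (Q.restrict L).polarBilin = ⊥ := by
      rw [← Submodule.finrank_eq_zero (R := ZMod 2)]
      grind
    exact ⟨le_bot_iff.mp (hker ▸ QuadraticMap.radical_le_ker_polarBilin), by rw [hker]; simp⟩
  · intro hB
    have hli : LinearIndependent (ZMod 2) ![p.1.rep, r.1.rep] := by
      rw [LinearIndependent.pair_iff' p.1.rep_nonzero]
      intro c hc
      rcases eq_or_ne c 0 with rfl | h0
      · exact r.1.rep_nonzero (by rw [← hc, zero_smul])
      · rw [zmod_two_ne_zero_iff.mp h0, one_smul] at hc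
        exact hne hc
    have hrank := finrank_span_eq_card hli
    rw [Matrix.range_cons_cons_empty, Fintype.card_fin] at hrank
    set L := Submodule.span (ZMod 2) {p.1.rep, r.1.rep}
    have hpL : p.1.rep ∈ L := Submodule.mem_span_of_mem (by simp)
    have hrL : r.1.rep ∈ L := Submodule.mem_span_of_mem (by simp)
    refine ⟨L, hrank, hpL, hrL, fun hnd => ?_⟩
    have hrad : (⟨p.1.rep + r.1.rep, L.add_mem hpL hrL⟩ : L) ∈ (Q.restrict L).radical := by
      refine ⟨?_, LinearMap.ext fun y => ?_⟩
      · change Q (p.1.rep + r.1.rep) = 0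
        rw [map_add_eq_add_polarBilin, hp, hr, hB]; decide
      · rw [restrict_polarBilin, LinearMap.zero_apply]
        obtain ⟨s, t, hst⟩ := Submodule.mem_span_pair.mp y.2
        rw [← hst]
        simp only [map_add, map_smul, LinearMap.add_apply, polarBilin_isAlt Q p.1.rep,
          polarBilin_isAlt Q r.1.rep, hB, polarBilin_comm Q r.1.rep p.1.rep]
        simp
    rw [hnd.radical_eq_bot, Submodule.mem_bot] at hrad
    have h0 : p.1.rep + r.1.rep = 0 := congrArg Subtype.val hrad
    refine hne (Eq.trans ?_ (zero_add _) )
    rw [← h0, add_assoc, ← two_smul (ZMod 2) r.1.rep, show (2 : ZMod 2) = 0 from rfl, zero_smul,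
      add_zero]

variable [FiniteDimensional (ZMod 2) V]

theorem isSwitchedOrthogonality_of_equiv {X V' W : Type*} [AddCommGroup V']
    [Module (ZMod 2) V'] [AddCommGroup W] [Module (ZMod 2) W]
    {Q : QuadraticForm (ZMod 2) V'} {R : QuadraticForm (ZMod 2) W} {G : SimpleGraph X}
    (e : V' ≃ₗ[ZMod 2] W) (he : ∀ x, R (e x) = Q x) (hG : IsSwitchedOrthogonality Q G) :
    IsSwitchedOrthogonality R G := by
  obtain ⟨f, h, hf⟩ := hG
  refine ⟨f.trans (e.toEquiv.subtypeEquiv fun a => by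
    change _ ↔ R (e a) = 1
    rw [he]), h, fun x y hxy => ?_⟩
  rw [hf x y hxy]
  have : R.polarBilin (e (f x).1) (e (f y).1) = Q.polarBilin (f x).1 (f y).1 := by
    simp only [QuadraticMap.polarBilin_apply_apply, QuadraticMap.polar, ← map_add, he]
  rw [← this]
  rfl

theorem exists_isometry_of_isOfType {W : Type*} [AddCommGroup W] [Module (ZMod 2) W]
    [FiniteDimensional (ZMod 2) W] {Q : QuadraticForm (ZMod 2) V} {R : QuadraticForm (ZMod 2) W}
    {m : ℕ} (hV : Module.finrank (ZMod 2) V = 2 * m) (hW : Module.finrank (ZMod 2) W = 2 * m)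
    {ε : ℤˣ} (hQ : IsOfType Q ε) (hR : IsOfType R ε) :
    ∃ e : V ≃ₗ[ZMod 2] W, ∀ x, R (e x) = Q x := by
  have hQk := ker_polarBilin_eq_bot hQ.nondegenerate (hV ▸ even_two_mul m)
  have hRk := ker_polarBilin_eq_bot hR.nondegenerate (hW ▸ even_two_mul m)
  refine exists_isometry_of_gaussSum_eq Q R hQk hRk (hV.trans hW.symm) ?_
  rw [(isOfType_iff_gaussSum _ signChar_ne_one Q hQk hV ε).mp hQ,
    (isOfType_iff_gaussSum _ signChar_ne_one R hRk hW ε).mp hR]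

theorem isSwitchedOrthogonality_evenNO {W : Type*} [AddCommGroup W] [Module (ZMod 2) W]
    [FiniteDimensional (ZMod 2) W] {Q : QuadraticForm (ZMod 2) V} {R : QuadraticForm (ZMod 2) W}
    {m : ℕ} (hV : Module.finrank (ZMod 2) V = 2 * m) (hW : Module.finrank (ZMod 2) W = 2 * m)
    {ε : ℤˣ} (hQ : IsOfType Q ε) (hR : IsOfType R ε) :
    IsSwitchedOrthogonality R (evenNO Q) := by
  obtain ⟨e, he⟩ := exists_isometry_of_isOfType hV hW hQ hR
  refine isSwitchedOrthogonality_of_equiv e he ⟨evenVertexEquiv Q, 0, fun x y hxy => ?_⟩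
  rw [evenNO_adj_iff Q hxy]
  simp [evenVertexEquiv]

end EvenDimension

/-! ### The absolute trace of the field of order 4 and its character. -/

section FieldOfOrderFour

variable {F : Type*} [Field F] [Fintype F]

theorem charP_two_of_card_eq_four (hF : Fintype.card F = 4) : CharP F 2 := by
  apply CharTwo.of_one_ne_zero_of_two_eq_zero one_ne_zero
  have h := FiniteField.cast_card_eq_zero F
  rw [hF] at h
  have h2 : (2 : F) * 2 = 0 := by norm_num at h ⊢; exact h
  exact mul_self_eq_zero.mp h2

variable [CharP F 2]

theorem sq_add_self_eq_zero_or_one (hF : Fintype.card F = 4) (x : F) :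
    x ^ 2 + x = 0 ∨ x ^ 2 + x = 1 := by
  have h := FiniteField.pow_card x
  rw [hF] at h
  have h1 : (x ^ 2 + x) * (x ^ 2 + x - 1) = 0 := by
    linear_combination h + (x ^ 3) * (CharTwo.two_eq_zero (R := F))
  rcases mul_eq_zero.mp h1 with h2 | h2
  · exact Or.inl h2
  · exact Or.inr (sub_eq_zero.mp h2)

open Classical in
/-- The absolute trace of the field with four elements. -/
noncomputable def traceFour (hF : Fintype.card F = 4) : F →+ ZMod 2 where
  toFun x := if x ^ 2 + x = 0 then 0 else 1
  map_zero' := by simp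
  map_add' x y := by
    have h : (x + y) ^ 2 + (x + y) = (x ^ 2 + x) + (y ^ 2 + y) := by
      rw [CharTwo.add_sq]; ring
    rw [h]
    rcases sq_add_self_eq_zero_or_one hF x with hx | hx <;>
      rcases sq_add_self_eq_zero_or_one hF y with hy | hy <;>
      simp [hx, hy, CharTwo.add_self_eq_zero]

theorem cast_traceFour (hF : Fintype.card F = 4) (x : F) :
    ZMod.castHom (dvd_refl 2) F (traceFour hF x) = x ^ 2 + x := by
  classical
  change ZMod.castHom (dvd_refl 2) F (if x ^ 2 + x = 0 then 0 else 1) = _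
  rcases sq_add_self_eq_zero_or_one hF x with hx | hx <;> simp [hx]

theorem traceFour_sq (hF : Fintype.card F = 4) (x : F) :
    traceFour hF (x ^ 2) = traceFour hF x := by
  apply (ZMod.castHom (dvd_refl 2) F).injective
  rw [cast_traceFour, cast_traceFour]
  rcases sq_add_self_eq_zero_or_one hF x with hx | hx <;>
  · rw [← CharTwo.add_sq, hx]; simp

theorem exists_cast_of_traceFour_eq_zero (hF : Fintype.card F = 4) {x : F}
    (hx : traceFour hF x = 0) : ∃ t : ZMod 2, ZMod.castHom (dvd_refl 2) F t = x := by
  have h := cast_traceFour hF x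
  rw [hx, map_zero] at h
  have h1 : x * (x + 1) = 0 := by rw [h]; ring
  rcases mul_eq_zero.mp h1 with h2 | h2
  · exact ⟨0, by rw [h2, map_zero]⟩
  · exact ⟨1, by rw [map_one]; exact (CharTwo.add_eq_zero.mp h2).symm⟩

/-- Elements of trace 0 lie in the prime field, which is too small to be everything. -/
theorem exists_traceFour_eq_one (hF : Fintype.card F = 4) : ∃ x : F, traceFour hF x = 1 := by
  by_contra! h
  have hsurj : Function.Surjective (ZMod.castHom (dvd_refl 2) F) := fun x =>
    exists_cast_of_traceFour_eq_zero hF (by_contra fun h0 => h x (zmod_two_ne_zero_iff.mp h0))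
  have := Fintype.card_le_of_surjective _ hsurj
  rw [hF, ZMod.card] at this
  omega

/-- The nontrivial additive character of the field with four elements given by the trace. -/
noncomputable def charFour (hF : Fintype.card F = 4) : AddChar F ℤ :=
  signChar.compAddMonoidHom (traceFour hF)

theorem charFour_apply (hF : Fintype.card F = 4) (x : F) :
    charFour hF x = if traceFour hF x = 0 then 1 else -1 := rfl

theorem charFour_ne_one (hF : Fintype.card F = 4) : charFour hF ≠ 1 := by
  obtain ⟨x, hx⟩ := exists_traceFour_eq_one hF
  exact AddChar.ne_one_iff.mpr ⟨x, by rw [charFour_apply, hx]; decide⟩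

theorem charFour_sq (hF : Fintype.card F = 4) (x : F) : charFour hF (x ^ 2) = charFour hF x := by
  rw [charFour_apply, charFour_apply, traceFour_sq]

end FieldOfOrderFour

/-! ### Trace descent of quadratic forms to the field of order 2. -/

section Transfer

variable {F U : Type*} [Field F] [AddCommGroup U] [Module F U] [Module (ZMod 2) U]

theorem map_zmod_two_smul {U A : Type*} [AddCommGroup U] [Module (ZMod 2) U] [AddCommGroup A]
    [Module (ZMod 2) A] {f : U → A} (h0 : f 0 = 0) (t : ZMod 2) (x : U) : f (t • x) = t • f x := by
  rcases eq_or_ne t 0 with rfl | ht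
  · rw [zero_smul, zero_smul, h0]
  · rw [zmod_two_ne_zero_iff.mp ht, one_smul, one_smul]

/-- The quadratic form over the field with two elements that is obtained by composing a quadratic
form with an additive map. -/
def transferForm (t : F →+ ZMod 2) (P : QuadraticForm F U) : QuadraticForm (ZMod 2) U where
  toFun x := t (P x)
  toFun_smul c x := by
    rw [map_zmod_two_smul (f := fun x => t (P x)) (by simp)]
    congr 1
    revert c; decide
  exists_companion' := ⟨LinearMap.mk₂ (ZMod 2) (fun x y => t (P.polarBilin x y))
    (fun _ _ _ => by simp) (fun c x y => map_zmod_two_smul (f := fun x => t (P.polarBilin x y))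
      (by simp) c x)
    (fun _ _ _ => by simp) (fun c x y => map_zmod_two_smul (f := fun y => t (P.polarBilin x y))
      (by simp) c y), fun x y => by
      rw [map_add_eq_add_polarBilin, map_add, map_add]; rfl⟩

theorem transferForm_apply (t : F →+ ZMod 2) (P : QuadraticForm F U) (x : U) :
    transferForm t P x = t (P x) := rfl

theorem transferForm_polarBilin (t : F →+ ZMod 2) (P : QuadraticForm F U) (x y : U) :
    (transferForm t P).polarBilin x y = t (P.polarBilin x y) := by
  simp [QuadraticMap.polarBilin_apply_apply, QuadraticMap.polar, transferForm_apply]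

/-- A nonzero value of the polar form can be scaled, in its second argument, to any element, in
particular to one not killed by `t`. -/
theorem transferForm_ker_polarBilin {t : F →+ ZMod 2} (ht : ∃ c, t c = 1) {P : QuadraticForm F U}
    (hP : LinearMap.ker P.polarBilin = ⊥) :
    LinearMap.ker (transferForm t P).polarBilin = ⊥ := by
  rw [Submodule.eq_bot_iff]
  intro x hx
  rw [← Submodule.mem_bot F, ← hP]
  refine LinearMap.ext fun y => ?_
  by_contra hy
  rw [LinearMap.zero_apply] at hy
  obtain ⟨c, hc⟩ := ht
  have h := LinearMap.congr_fun hx ((c / P.polarBilin x y) • y)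
  rw [transferForm_polarBilin, map_smul, smul_eq_mul, div_mul_cancel₀ _ hy, hc] at h
  exact one_ne_zero h

theorem transferForm_isOfType [Fintype F] [CharP F 2] [FiniteDimensional F U]
    [FiniteDimensional (ZMod 2) U]
    (hF : Fintype.card F = 4) {P : QuadraticForm F U} (hP : LinearMap.ker P.polarBilin = ⊥)
    {m : ℕ} (hm : Module.finrank F U = 2 * m) {ε : ℤˣ} (hε : IsOfType P ε) :
    Module.finrank (ZMod 2) U = 2 * (2 * m) ∧ IsOfType (transferForm (traceFour hF) P) ε := by
  have hdim : Module.finrank (ZMod 2) U = 2 * (2 * m) := by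
    have h1 := Module.natCard_eq_pow_finrank (K := F) (V := U)
    have h2 := Module.natCard_eq_pow_finrank (K := ZMod 2) (V := U)
    rw [Nat.card_eq_fintype_card (α := F), hF, hm] at h1
    rw [h1, Nat.card_zmod, show 4 = 2 ^ 2 from rfl, ← pow_mul] at h2
    exact (Nat.pow_right_injective le_rfl h2).symm
  refine ⟨hdim, ?_⟩
  rw [isOfType_iff_gaussSum signChar signChar_ne_one _
    (transferForm_ker_polarBilin (exists_traceFour_eq_one hF) hP) hdim]
  rw [isOfType_iff_gaussSum (charFour hF) (charFour_ne_one hF) P hP hm, hF] at hε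
  rw [ZMod.card, pow_mul]
  -- The two exponential sums agree by definition, and `(2^2)^m` is `4^m`.
  exact hε

end Transfer

/-! ### Hyperplanes off the nucleus and their pairwise intersections. -/

section Complements

variable {F V : Type*} [Field F] [AddCommGroup V] [Module F V]

/-- The vector `n` spans the nucleus of `P`, is normalized by `P n = 1`, and `φ` is a linear form
with `φ n = 1`. -/
structure IsNucleusPair (P : QuadraticForm F V) (n : V) (φ : V →ₗ[F] F) : Prop where
  ker_eq : LinearMap.ker P.polarBilin = Submodule.span F {n}
  value : P n = 1
  apply_eq : φ n = 1

namespace IsNucleusPair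

variable {P : QuadraticForm F V} {n : V} {φ : V →ₗ[F] F}

theorem polarBilin_left (h : IsNucleusPair P n φ) : P.polarBilin n = 0 := by
  rw [← LinearMap.mem_ker, h.ker_eq]
  exact Submodule.mem_span_singleton_self n

theorem polarBilin_right (h : IsNucleusPair P n φ) (x : V) : P.polarBilin x n = 0 := by
  rw [polarBilin_comm, h.polarBilin_left, LinearMap.zero_apply]

theorem add_smul_apply (h : IsNucleusPair P n φ) (x : V) (t : F) :
    P (x + t • n) = P x + t ^ 2 := by
  rw [map_add_eq_add_polarBilin, QuadraticMap.map_smul, map_smul, h.polarBilin_right, h.value]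
  simp [sq]

theorem add_polarBilin (h : IsNucleusPair P n φ) (a : V) :
    IsNucleusPair P n (φ + P.polarBilin a) :=
  ⟨h.ker_eq, h.value, by rw [LinearMap.add_apply, h.apply_eq, h.polarBilin_right, add_zero]⟩

theorem eq_zero_of_mem_ker (h : IsNucleusPair P n φ) {x : V} (hx : φ x = 0)
    (hB : P.polarBilin x = 0) : x = 0 := by
  rw [← LinearMap.mem_ker, h.ker_eq] at hB
  obtain ⟨c, rfl⟩ := Submodule.mem_span_singleton.mp hB
  rw [map_smul, h.apply_eq, smul_eq_mul, mul_one] at hx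
  rw [hx, zero_smul]

/-- The nucleus is a complement of `ker φ` and is orthogonal to everything, so the radical of the
restriction lies in the nucleus and in `ker φ`. -/
theorem ker_restrict (h : IsNucleusPair P n φ) :
    LinearMap.ker (P.restrict (LinearMap.ker φ)).polarBilin = ⊥ := by
  rw [Submodule.eq_bot_iff]
  intro x hx
  refine Subtype.ext (h.eq_zero_of_mem_ker x.2 (LinearMap.ext fun y => ?_))
  have h1 : y - φ y • n ∈ LinearMap.ker φ := by simp [h.apply_eq]
  have h2 := LinearMap.congr_fun hx ⟨_, h1⟩
  rw [restrict_polarBilin, map_sub, map_smul, h.polarBilin_right, smul_zero, sub_zero] at h2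
  exact h2

theorem finrank_ker [FiniteDimensional F V] (h : IsNucleusPair P n φ) :
    Module.finrank F (LinearMap.ker φ) + 1 = Module.finrank F V :=
  Module.Dual.finrank_ker_add_one_of_ne_zero (fun h0 => by simpa [h0] using h.apply_eq)

theorem not_nucleus_le (h : IsNucleusPair P n φ) : ¬ nucleus P ≤ LinearMap.ker φ := by
  rw [nucleus, h.ker_eq, Submodule.span_singleton_le_iff_mem, LinearMap.mem_ker, h.apply_eq]
  exact one_ne_zero

/-- Both functionals take the value 1 at `n`, so equal kernels make them equal, and `⟨a - b,·⟩ = 0`.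
-/
theorem eq_of_ker_eq (h : IsNucleusPair P n φ) {a b : V} (ha : φ a = 0) (hb : φ b = 0)
    (hab : LinearMap.ker (φ + P.polarBilin a) = LinearMap.ker (φ + P.polarBilin b)) : a = b := by
  rw [← sub_eq_zero]
  refine h.eq_zero_of_mem_ker (by rw [map_sub, ha, hb, sub_zero]) (LinearMap.ext fun y => ?_)
  have h1 : y - (φ + P.polarBilin a) y • n ∈ LinearMap.ker (φ + P.polarBilin a) := by
    rw [LinearMap.mem_ker, map_sub, map_smul, (h.add_polarBilin a).apply_eq, smul_eq_mul, mul_one,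
      sub_self]
  rw [hab, LinearMap.mem_ker, map_sub, map_smul, (h.add_polarBilin b).apply_eq, smul_eq_mul,
    mul_one, LinearMap.add_apply, LinearMap.add_apply] at h1
  rw [map_sub, LinearMap.sub_apply, LinearMap.zero_apply]
  linear_combination -h1

/-- Normalize a functional `θ` cutting out `H` by `θ n = 1`, and represent its restriction to `ker
φ` by a vector `a` there. Then `θ` and `φ + ⟨a,·⟩` agree on `ker φ` and at `n`. -/
theorem exists_ker_eq [CharP F 2] [FiniteDimensional F V] (h : IsNucleusPair P n φ)
    {H : Submodule F V} (hH : Module.finrank F H + 1 = Module.finrank F V)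
    (hn : ¬ nucleus P ≤ H) : ∃ a, φ a = 0 ∧ LinearMap.ker (φ + P.polarBilin a) = H := by
  rw [nucleus, h.ker_eq, Submodule.span_singleton_le_iff_mem] at hn
  obtain ⟨θ', hθ', hle⟩ := Submodule.exists_le_ker_of_notMem hn
  obtain ⟨θ, hθ, hker⟩ : ∃ θ : V →ₗ[F] F, θ n = 1 ∧ H ≤ LinearMap.ker θ :=
    ⟨(θ' n)⁻¹ • θ', by simp [hθ'], fun x hx => by
      simp [LinearMap.mem_ker.mp (hle hx)]⟩
  have hrank := Module.Dual.finrank_ker_add_one_of_ne_zero (f := θ)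
    (fun h0 => by simp [h0] at hθ)
  have hHker : H = LinearMap.ker θ := Submodule.eq_of_le_of_finrank_eq hker (by omega)
  have hnd := nondegenerate_of_isRefl_of_ker_eq_bot
    (polarBilin_isAlt (P.restrict (LinearMap.ker φ))).isRefl h.ker_restrict
  obtain ⟨a, ha⟩ := (LinearMap.BilinForm.toDual _ hnd).surjective (θ.domRestrict (LinearMap.ker φ))
  refine ⟨a, a.2, ?_⟩
  rw [hHker]
  congr 1
  ext y
  have h1 : y - φ y • n ∈ LinearMap.ker φ := by simp [h.apply_eq]
  have h2 := LinearMap.congr_fun ha ⟨_, h1⟩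
  rw [LinearMap.BilinForm.toDual_def, restrict_polarBilin, map_sub, map_smul, h.polarBilin_right,
    smul_zero, sub_zero, LinearMap.domRestrict_apply, map_sub, map_smul, hθ] at h2
  rw [LinearMap.add_apply, h2]
  simp

/-- Sliding along the nucleus by `x ↦ x + ⟨a,x⟩ n` carries `ker φ` onto the other hyperplane and
adds `⟨a,x⟩²` to `P x`. Since `ψ` ignores squaring, this acts as `⟨a,x⟩`, and `P x + ⟨a,x⟩ = P (x +
a) + P a`. -/
theorem gaussSum_restrict [CharP F 2] [Finite V] (h : IsNucleusPair P n φ) (ψ : AddChar F ℤ)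
    (hsq : ∀ x, ψ (x ^ 2) = ψ x) {a : V} (ha : φ a = 0) :
    gaussSum ψ (P.restrict (LinearMap.ker (φ + P.polarBilin a))) =
      ψ (P a) * gaussSum ψ (P.restrict (LinearMap.ker φ)) := by
  let _ := Fintype.ofFinite V
  let _ := Fintype.ofFinite (LinearMap.ker φ)
  let _ := Fintype.ofFinite (LinearMap.ker (φ + P.polarBilin a))
  let e : LinearMap.ker φ ≃ LinearMap.ker (φ + P.polarBilin a) :=
    { toFun := fun x => ⟨x.1 + P.polarBilin a x.1 • n, by
        have := x.2
        rw [LinearMap.mem_ker] at this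
        simp only [LinearMap.mem_ker, LinearMap.add_apply, map_add, map_smul, this, h.apply_eq,
          h.polarBilin_right]
        simp [CharTwo.add_self_eq_zero]⟩
      invFun := fun y => ⟨y.1 + φ y.1 • n, by
        simp [h.apply_eq, CharTwo.add_self_eq_zero]⟩
      left_inv := fun x => Subtype.ext (by
        have := x.2
        rw [LinearMap.mem_ker] at this
        simp only [map_add, map_smul, this, h.apply_eq, smul_eq_mul, mul_one, zero_add, add_assoc,
          ← add_smul, CharTwo.add_self_eq_zero, zero_smul, add_zero])
      right_inv := fun y => Subtype.ext (by
        have := y.2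
        rw [LinearMap.mem_ker, LinearMap.add_apply] at this
        simp only [map_add, map_smul, h.polarBilin_right, smul_zero, add_zero, add_assoc,
          ← add_smul, this, zero_smul]) }
  simp only [gaussSum, finsum_eq_sum_of_fintype]
  rw [← Equiv.sum_comp e, ← Equiv.sum_comp (Equiv.addRight (⟨a, ha⟩ : LinearMap.ker φ))
    (fun x => ψ (P.restrict (LinearMap.ker φ) x)), Finset.mul_sum]
  refine Finset.sum_congr rfl fun x _ => ?_
  change ψ (P (x.1 + P.polarBilin a x.1 • n)) = ψ (P a) * ψ (P (x.1 + a))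
  rw [h.add_smul_apply, AddChar.map_add_eq_mul, hsq, ← AddChar.map_add_eq_mul,
    ← AddChar.map_add_eq_mul, map_add_eq_add_polarBilin, polarBilin_comm P x.1 a]
  congr 1
  linear_combination -CharTwo.add_self_eq_zero (P a)

/-- The bilinear radical of the intersection is the line spanned by `a + b + ⟨a,b⟩ n`, so degeneracy
means that `P` vanishes at this vector. -/
theorem meetsDegenerately_iff [CharP F 2] [FiniteDimensional F V] (h : IsNucleusPair P n φ)
    {a b : V} (ha : φ a = 0) (hb : φ b = 0) (hab : a ≠ b) :
    MeetsDegenerately P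
      (LinearMap.ker (φ + P.polarBilin a) ⊓ LinearMap.ker (φ + P.polarBilin b)) ↔
      P a + P b + P.polarBilin a b + P.polarBilin a b ^ 2 = 0 := by
  set D := LinearMap.ker (φ + P.polarBilin a) ⊓ LinearMap.ker (φ + P.polarBilin b) with hD
  have hmem : ∀ x, x ∈ D ↔ φ x + P.polarBilin a x = 0 ∧ φ x + P.polarBilin b x = 0 :=
    fun x => Iff.rfl
  have haa : P.polarBilin a a = 0 := polarBilin_isAlt P a
  have hbb : P.polarBilin b b = 0 := polarBilin_isAlt P b
  have hba : P.polarBilin b a = P.polarBilin a b := polarBilin_comm P b a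
  set s := P.polarBilin a b with hs
  have hcD : a + b + s • n ∈ D := by
    rw [hmem]
    simp only [map_add, map_smul, ha, hb, haa, hbb, hba, h.apply_eq, h.polarBilin_right, ← hs]
    simp [CharTwo.add_self_eq_zero]
  have hPc : P (a + b + s • n) = P a + P b + s + s ^ 2 := by
    rw [h.add_smul_apply, map_add_eq_add_polarBilin, hs]
  rw [← hPc]
  have hcker : (⟨a + b + s • n, hcD⟩ : D) ∈ LinearMap.ker (P.restrict D).polarBilin := by
    refine LinearMap.ext fun y => ?_
    obtain ⟨h1, h2⟩ := (hmem _).mp y.2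
    rw [restrict_polarBilin]
    simp only [map_add, map_smul, h.polarBilin_left, LinearMap.add_apply, smul_zero, add_zero,
      LinearMap.zero_apply]
    linear_combination h1 + h2 - CharTwo.add_self_eq_zero (φ y.1)
  have hspan : LinearMap.ker (P.restrict D).polarBilin ≤
      Submodule.span F {(⟨a + b + s • n, hcD⟩ : D)} := by
    intro v hv
    -- The intersection is also cut out by `φ + ⟨a,·⟩` and `⟨a + b,·⟩`; a functional vanishing on it
    -- is a combination of these two.
    have hle : ⨅ i, LinearMap.ker (![φ + P.polarBilin a, P.polarBilin (a + b)] i) ≤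
        LinearMap.ker (P.polarBilin v.1) := by
      intro x hx
      simp only [Submodule.mem_iInf, Fin.forall_fin_two, Matrix.cons_val_zero, Matrix.cons_val_one,
        LinearMap.mem_ker, map_add, LinearMap.add_apply] at hx
      have hxD : x ∈ D := (hmem x).mpr ⟨hx.1, by
        linear_combination hx.1 + hx.2 - CharTwo.add_self_eq_zero (P.polarBilin a x)⟩
      exact LinearMap.congr_fun hv ⟨x, hxD⟩
    have hsp := mem_span_of_iInf_ker_le_ker hle
    rw [Matrix.range_cons_cons_empty, Submodule.mem_span_pair] at hsp
    obtain ⟨c, t, hct⟩ := hsp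
    -- Evaluate at `n`: only `φ` is nonzero there.
    have hc : c = 0 := by
      have := LinearMap.congr_fun hct n
      simpa [h.apply_eq, h.polarBilin_right] using this
    rw [hc, zero_smul, zero_add] at hct
    have hker : v.1 - t • (a + b) ∈ LinearMap.ker P.polarBilin := by
      rw [LinearMap.mem_ker, map_sub, map_smul, hct, sub_self]
    rw [h.ker_eq] at hker
    obtain ⟨r, hr⟩ := Submodule.mem_span_singleton.mp hker
    have hv' : v.1 = t • (a + b) + r • n := by rw [hr]; abel
    have hrt : r = t * s := by
      have h1 := ((hmem _).mp v.2).1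
      rw [hv'] at h1
      simp only [map_add, map_smul, ha, hb, haa, h.apply_eq, h.polarBilin_right, ← hs,
        smul_eq_mul] at h1
      linear_combination h1 - CharTwo.add_self_eq_zero (t * s)
    refine Submodule.mem_span_singleton.mpr ⟨t, Subtype.ext ?_⟩
    change t • (a + b + s • n) = v.1
    rw [hv', hrt, smul_add, smul_smul]
  constructor
  · intro hdeg
    by_contra hPne
    refine hdeg ⟨(Submodule.eq_bot_iff _).mpr fun x hx => ?_, ?_⟩
    · obtain ⟨t, rfl⟩ := Submodule.mem_span_singleton.mp (hspan hx.2)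
      have h1 := hx.1
      rw [QuadraticMap.map_smul, QuadraticMap.restrict_apply, smul_eq_mul] at h1
      have ht : t = 0 := by simpa [hPne] using h1
      rw [ht, zero_smul]
    · exact (Submodule.rank_mono hspan).trans ((rank_span_le _).trans (by simp))
  · intro hP0 hnd
    have hrad : (⟨a + b + s • n, hcD⟩ : D) ∈ (P.restrict D).radical := ⟨hP0, hcker⟩
    rw [hnd.radical_eq_bot, Submodule.mem_bot] at hrad
    have h0 : a + b + s • n = 0 := congrArg Subtype.val hrad
    -- The spanning vector is nonzero: applying `φ` gives `s = 0`, and then `a = b`.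
    have hs0 : s = 0 := by
      have := congrArg φ h0
      simpa [ha, hb, h.apply_eq] using this
    rw [hs0, zero_smul, add_zero] at h0
    apply hab
    rw [eq_neg_of_add_eq_zero_left h0, ← neg_one_smul F b, CharTwo.neg_eq, one_smul]

end IsNucleusPair

end Complements

/-! ### The hyperplane graphs over the field of order 4. -/

section OddDimension

variable {F V : Type*} [Field F] [Fintype F] [CharP F 2] [AddCommGroup V] [Module F V]
  [FiniteDimensional F V]

theorem exists_isNucleusPair {P : QuadraticForm F V} (hP : P.Nondegenerate)
    (hV : Odd (Module.finrank F V)) : ∃ n φ, IsNucleusPair P n φ := by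
  have h1 := even_finrank_add_finrank_ker _ (polarBilin_isAlt P)
  have h2 := Module.finrank_le_of_rank_le (n := 1) (by simpa using hP.rank_rad_polar_le)
  have h3 : Module.finrank F (LinearMap.ker P.polarBilin) = 1 := by grind
  obtain ⟨v, hv, hspan⟩ := finrank_eq_one_iff'.mp h3
  have hPv : P v.1 ≠ 0 := fun h0 => hv (Subtype.ext <| by
    have : v.1 ∈ P.radical := ⟨h0, v.2⟩
    rwa [hP.radical_eq_bot, Submodule.mem_bot] at this)
  -- The square root of `(P v)⁻¹` rescales the radical vector to value 1.
  obtain ⟨d, hd⟩ := FiniteField.isSquare_of_char_two (ringChar.eq F 2) (P v.1)⁻¹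
  have hd0 : d ≠ 0 := fun h0 => hPv (by simpa [h0] using hd)
  have hn0 : d • v.1 ≠ 0 := smul_ne_zero hd0 (fun h0 => hv (Subtype.ext h0))
  obtain ⟨θ, hθ⟩ := Module.Projective.exists_dual_eq_one F hn0
  refine ⟨d • v.1, θ, le_antisymm (fun x hx => ?_) ?_, ?_, hθ⟩
  · obtain ⟨c, hc⟩ := hspan ⟨x, hx⟩
    refine Submodule.mem_span_singleton.mpr ⟨c / d, ?_⟩
    rw [smul_smul, div_mul_cancel₀ _ hd0]
    exact congrArg Subtype.val hc
  · rw [Submodule.span_singleton_le_iff_mem]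
    exact Submodule.smul_mem _ _ v.2
  · rw [QuadraticMap.map_smul, ← hd, smul_eq_mul, inv_mul_cancel₀ hPv]

/-- If `ker φ` has the wrong type, adding `⟨a,·⟩` with `Tr (P a) = 1` flips the sign of the sum.
Such an `a` exists because `Tr ∘ P` has a nonzero polar form on `ker φ`, a nonzero space as `m ≥ 1`.
-/
theorem IsNucleusPair.exists_isOfType {P : QuadraticForm F V} {n : V} {φ : V →ₗ[F] F}
    (hF : Fintype.card F = 4) {m : ℕ} (hm : 1 ≤ m) (hV : Module.finrank F V = 2 * m + 1)
    (h : IsNucleusPair P n φ) (ε : ℤˣ) :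
    ∃ φ, IsNucleusPair P n φ ∧ IsOfType (P.restrict (LinearMap.ker φ)) ε := by
  have : Finite V := Module.finite_of_finite F
  have hdim : ∀ θ : V →ₗ[F] F, IsNucleusPair P n θ →
      Module.finrank F (LinearMap.ker θ) = 2 * m := fun θ hθ => by
    have := hθ.finrank_ker
    omega
  have htype := fun (θ : V →ₗ[F] F) (hθ : IsNucleusPair P n θ) (δ : ℤˣ) =>
    isOfType_iff_gaussSum (charFour hF) (charFour_ne_one hF) _ hθ.ker_restrict (hdim θ hθ) δ
  have hφ : IsOfType (P.restrict (LinearMap.ker φ)) ε ∨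
      IsOfType (P.restrict (LinearMap.ker φ)) (-ε) := by
    rw [htype φ h, htype φ h]
    rcases finrank_eq_and_gaussSum (charFour hF) (charFour_ne_one hF) _ h.ker_restrict (hdim φ h)
      with ⟨-, h1⟩ | ⟨-, h1⟩ <;> rcases Int.units_eq_one_or ε with rfl | rfl <;> simp [h1]
  rcases hφ with h1 | h1
  · exact ⟨φ, h, h1⟩
  obtain ⟨a, ha, hta⟩ : ∃ a, φ a = 0 ∧ traceFour hF (P a) = 1 := by
    have hnt : Nontrivial (LinearMap.ker φ) :=
      Module.nontrivial_of_finrank_pos (R := F) (by rw [hdim φ h]; omega)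
    obtain ⟨x, hx⟩ := exists_ne (0 : LinearMap.ker φ)
    by_contra! hall
    have hall' : ∀ a : LinearMap.ker φ, traceFour hF (P a.1) = 0 := fun a =>
      by_contra fun h0 => hall a a.2 (zmod_two_ne_zero_iff.mp h0)
    apply hx
    rw [← Submodule.mem_bot F, ← h.ker_restrict]
    refine LinearMap.ext fun y => ?_
    by_contra hy
    rw [restrict_polarBilin, LinearMap.zero_apply] at hy
    obtain ⟨c, hc⟩ := exists_traceFour_eq_one hF
    have h2 := hall' (x + (c / P.polarBilin x.1 y.1) • y)
    have h3 := hall' x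
    have h4 := hall' ((c / P.polarBilin x.1 y.1) • y)
    rw [Submodule.coe_add, map_add_eq_add_polarBilin, map_add, map_add, h3, h4, Submodule.coe_smul, map_smul,
      smul_eq_mul, div_mul_cancel₀ _ hy, hc] at h2
    exact absurd h2 (by decide)
  refine ⟨φ + P.polarBilin a, h.add_polarBilin a, ?_⟩
  rw [htype φ h] at h1
  rw [htype _ (h.add_polarBilin a), h.gaussSum_restrict _ (charFour_sq hF) ha, h1, charFour_apply,
    hta, if_neg one_ne_zero]
  push_cast
  ring

theorem isSwitchedOrthogonality_oddNO {W : Type*} [AddCommGroup W] [Module (ZMod 2) W]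
    [FiniteDimensional (ZMod 2) W] (hF : Fintype.card F = 4) {m : ℕ} (hm : 1 ≤ m)
    (hV : Module.finrank F V = 2 * m + 1) (hW : Module.finrank (ZMod 2) W = 2 * (2 * m))
    {P : QuadraticForm F V} (hP : P.Nondegenerate) {R : QuadraticForm (ZMod 2) W} {ε : ℤˣ}
    (hR : IsOfType R ε) : IsSwitchedOrthogonality R (oddNO P (-ε)) := by
  have : Finite V := Module.finite_of_finite F
  obtain ⟨n, φ', h'⟩ := exists_isNucleusPair hP (hV ▸ odd_two_mul_add_one m)
  obtain ⟨φ, h, hφ⟩ := h'.exists_isOfType hF hm hV ε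
  have hdim : ∀ θ : V →ₗ[F] F, IsNucleusPair P n θ →
      Module.finrank F (LinearMap.ker θ) = 2 * m := fun θ hθ => by
    have := hθ.finrank_ker
    omega
  have htype := fun (θ : V →ₗ[F] F) (hθ : IsNucleusPair P n θ) (δ : ℤˣ) =>
    isOfType_iff_gaussSum (charFour hF) (charFour_ne_one hF) _ hθ.ker_restrict (hdim θ hθ) δ
  let _ : Module (ZMod 2) (LinearMap.ker φ) := Module.compHom _ (ZMod.castHom (dvd_refl 2) F)
  set Q := transferForm (traceFour hF) (P.restrict (LinearMap.ker φ)) with hQ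
  have hQP : ∀ x, Q x = traceFour hF (P x.1) := fun x => rfl
  obtain ⟨hQdim, hQε⟩ := transferForm_isOfType hF h.ker_restrict (hdim φ h) hφ
  obtain ⟨e, he⟩ := exists_isometry_of_isOfType hQdim hW hQε hR
  -- Starting from type `ε`, the sign `ψ (P a)` must be `-1` to reach type `-ε`.
  have hmem : ∀ a, φ a = 0 → (traceFour hF (P a) = 1 ↔
      IsOfType (P.restrict (LinearMap.ker (φ + P.polarBilin a))) (-ε)) := by
    intro a ha
    have hε := (htype φ h ε).mp hφ
    rw [htype _ (h.add_polarBilin a), h.gaussSum_restrict _ (charFour_sq hF) ha, hε,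
      charFour_apply, ← zmod_two_ne_zero_iff, hF]
    have hpos : (0 : ℤ) < 4 ^ m := by positivity
    by_cases h0 : traceFour hF (P a) = 0 <;> rcases Int.units_eq_one_or ε with rfl | rfl <;>
      simp [h0] <;> omega
  let g : {a : LinearMap.ker φ // Q a = 1} → hyperplanesOfType P (-ε) := fun a =>
    ⟨LinearMap.ker (φ + P.polarBilin a.1.1), (h.add_polarBilin a.1.1).finrank_ker,
      (h.add_polarBilin a.1.1).not_nucleus_le, (hmem _ a.1.2).mp a.2⟩
  have hg : Function.Bijective g := by
    constructor
    · intro a b hab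
      exact Subtype.ext (Subtype.ext (h.eq_of_ker_eq a.1.2 b.1.2 (congrArg Subtype.val hab)))
    · rintro ⟨H, hH, hn, hε⟩
      obtain ⟨a, ha, rfl⟩ := h.exists_ker_eq hH hn
      exact ⟨⟨⟨a, ha⟩, (hmem a ha).mpr hε⟩, rfl⟩
  -- All vertices have `Tr (P a) = 1`, so `P a` differs from the fixed `ω` by an element `k a` of
  -- the prime field; `k` is the switching function.
  obtain ⟨ω, hω⟩ := exists_traceFour_eq_one hF
  have hk : ∀ a : {a : LinearMap.ker φ // Q a = 1}, ∃ t : ZMod 2,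
      ZMod.castHom (dvd_refl 2) F t = P a.1.1 - ω := fun a =>
    exists_cast_of_traceFour_eq_zero hF (by rw [map_sub, ← hQP, a.2, hω, sub_self])
  choose k hk using hk
  refine isSwitchedOrthogonality_of_equiv e he
    ⟨(Equiv.ofBijective g hg).symm, fun x => k ((Equiv.ofBijective g hg).symm x), ?_⟩
  intro x y hxy
  obtain ⟨a, rfl⟩ := (Equiv.ofBijective g hg).surjective x
  obtain ⟨b, rfl⟩ := (Equiv.ofBijective g hg).surjective y
  have hab : a ≠ b := fun h0 => hxy (by rw [h0])
  simp only [Equiv.symm_apply_apply]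
  change _ ≠ _ ∧ MeetsDegenerately P (LinearMap.ker (φ + P.polarBilin a.1.1) ⊓
    LinearMap.ker (φ + P.polarBilin b.1.1)) ↔ _
  rw [and_iff_right hxy, h.meetsDegenerately_iff a.1.2 b.1.2
    (fun h0 => hab (Subtype.ext (Subtype.ext h0))), transferForm_polarBilin, restrict_polarBilin,
    ← map_eq_zero_iff _ (ZMod.castHom (dvd_refl 2) F).injective, map_add, map_add, hk, hk,
    cast_traceFour]
  -- Both sides are now equations over the field of order 4, differing only by `ω + ω = 0`.
  have h2 := CharTwo.add_self_eq_zero ω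
  exact ⟨fun h1 => by linear_combination h1 - h2, fun h1 => by linear_combination h1 + h2⟩

end OddDimension

end PolarTwoGraph

theorem mainTheorem1 {F : Type*} [Field F] [Fintype F] (hF : Fintype.card F = 4)
    (m : ℕ) (hm : 1 ≤ m) (ε : ℤˣ) :
    (∀ Q Q' : QuadraticForm (ZMod 2) (Fin (2 * m) → ZMod 2),
      PolarTwoGraph.IsOfType Q ε → PolarTwoGraph.IsOfType Q' ε →
        Nonempty (PolarTwoGraph.TwoGraph.Iso
          (PolarTwoGraph.associatedTwoGraph (PolarTwoGraph.evenNO Q))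
          (PolarTwoGraph.symplecticTwoGraph Q'))) ∧
    (∀ (P : QuadraticForm F (Fin (2 * m + 1) → F))
      (Q : QuadraticForm (ZMod 2) (Fin (4 * m) → ZMod 2)),
      PolarTwoGraph.IsParabolic P → PolarTwoGraph.IsOfType Q ε →
        Nonempty (PolarTwoGraph.TwoGraph.Iso
          (PolarTwoGraph.associatedTwoGraph (PolarTwoGraph.oddNO P (-ε)))
          (PolarTwoGraph.symplecticTwoGraph Q))) ∧
    (∀ (Q : QuadraticForm (ZMod 2) (Fin (4 * m) → ZMod 2))
      (P : QuadraticForm F (Fin (2 * m + 1) → F)),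
      PolarTwoGraph.IsOfType Q ε → PolarTwoGraph.IsParabolic P →
        PolarTwoGraph.SwitchingEquivalent
          (PolarTwoGraph.evenNO Q) (PolarTwoGraph.oddNO P (-ε))) := by
  have := PolarTwoGraph.charP_two_of_card_eq_four hF
  have h2 : Module.finrank (ZMod 2) (Fin (2 * m) → ZMod 2) = 2 * m := by simp
  have h4 : Module.finrank (ZMod 2) (Fin (4 * m) → ZMod 2) = 2 * (2 * m) := by
    rw [Module.finrank_fin_fun]; ring
  have h5 : Module.finrank F (Fin (2 * m + 1) → F) = 2 * m + 1 := by simp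
  have hodd := fun (P : QuadraticForm F (Fin (2 * m + 1) → F))
      (Q : QuadraticForm (ZMod 2) (Fin (4 * m) → ZMod 2)) (hP : PolarTwoGraph.IsParabolic P)
      (hQ : PolarTwoGraph.IsOfType Q ε) =>
    PolarTwoGraph.isSwitchedOrthogonality_oddNO hF hm h5 h4 hP.1 hQ
  exact ⟨fun Q Q' hQ hQ' =>
      (PolarTwoGraph.isSwitchedOrthogonality_evenNO h2 h2 hQ hQ').nonempty_iso,
    fun P Q hP hQ => (hodd P Q hP hQ).nonempty_iso,
    fun Q P hQ hP => (PolarTwoGraph.isSwitchedOrthogonality_evenNO h4 h4 hQ hQ).switchingEquivalent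
      (hodd P Q hP hQ)⟩
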